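/- **Setting.** There are $M$ agents and a server, a horizon $T$, and an unknown $\theta^*\in\mathbb R^d$ with $\|\theta^*\|_2\le S$. In round $t=1,\dots,T$ an arbitrary agent $m_t\in[M]$ is active, receives an arbitrary decision set $D_t\subset\mathbb R^d$ with $\|x\|_2\le L$ for all $x\in D_t$, plays $x_t\in D_t$ and receives $r_t=\langle x_t,\theta^*\rangle+\eta_t$, where for some $R\ge 0$ $$\mathbb E\big[e^{s\eta_t}\mid x_{1:t},m_{1:t},r_{1:t-1}\big]\le e^{R^2s^2/2}\qquad\text{for all } s\in\mathbb R .$$ The regret is $\mathrm{Regret}(T)=\sum_{t=1}^T\big(\sup_{x\in D_t}\langle x,\theta^*\rangle-\langle x_t,\theta^*\rangle\big)$. **Algorithm (FedLinUCB)** with parameters $\alpha,\lambda>0$ and $\beta$. Write $\|x\|_A=\sqrt{x^\top Ax}$. Initially $\Sigma_m=\Sigma^{\mathrm{ser}}=\lambda I$, $\hat\theta_m=0$, $b^{\mathrm{ser}}=0$, $\Sigma_m^{\mathrm{loc}}=0$, $b_m^{\mathrm{loc}}=0$ for every agent $m$. In round $t$, with $m=m_t$, the active agent plays a maximizer $x_t$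 of $\langle\hat\theta_m,x\rangle+\beta\|x\|_{\Sigma_m^{-1}}$ over $x\in D_t$, and adds $x_tx_t^\top$ to $\Sigma_m^{\mathrm{loc}}$ and $r_tx_t$ to $b_m^{\mathrm{loc}}$. If then $\det(\Sigma_m+\Sigma_m^{\mathrm{loc}})>(1+\alpha)\det\Sigma_m$, agent $m$ uploads $(\Sigma_m^{\mathrm{loc}},b_m^{\mathrm{loc}})$, the server adds them to $(\Sigma^{\mathrm{ser}},b^{\mathrm{ser}})$, the local data of $m$ are reset to $0$, and $m$ downloads the server data: $\Sigma_m\leftarrow\Sigma^{\mathrm{ser}}$, $\hat\theta_m\leftarrow(\Sigma^{\mathrm{ser}})^{-1}b^{\mathrm{ser}}$. Nothing else changes. The communication complexity is the total number of uploads and downloads in the $T$ rounds; the switching cost is the number of times an agent's decision rule $(\hat\theta_m,\Sigma_m)$ changes. **Theorem.** Let $0<\delta<1$ and $$\beta=\sqrt\lambda S+\big(\sqrt{1+M\alpha}+M\sqrt{2\alpha}\big)\Big(R\sqrt{d\log\big((1+TL^2/(\min(\alpha,1)\lambda))/\delta\big)}+\sqrt\lambda S\Big).$$ 1. If $d\ge2$,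 then with probability at least $1-\delta$, $$\mathrm{Regret}(T)\le 2dSLM\log(1+TL^2/\lambda)+2\sqrt{2(1+M\alpha)}\,\beta\sqrt{2dT\log(1+TL^2/\lambda)} .$$ 2. The communication complexity is at most $\frac{2}{\log 2}\,d\,(M+1/\alpha)\log\big(1+TL^2/(\lambda d)\big)$, and the switching cost is at most $2\log 2\cdot d\,(M+1/\alpha)\log\big(1+TL^2/(\lambda d)\big)$ (here $\log$ is the natural logarithm). 3. Let $\alpha=1/M^2$ and $\ell=\log\big((1+TM^2L^2/\lambda)/\delta\big)$. If $d\ge 2$, then with probability at least $1-\delta$, $$\mathrm{Regret}(T)\le\big(22\sqrt\lambda S\sqrt{\ell}+16R\,\ell\big)\,d\sqrt T+2dSLM\log(1+TL^2/\lambda),$$ which is $\tilde O(d\sqrt T)$ (the last term depends on $T$ only through a logarithm); the communication complexity is at most $\frac{4}{\log 2}\,dM^2\log\big(1+TL^2/(\lambda d)\big)$ and the switching cost at most $4\log 2\cdot dM^2\log\big(1+TL^2/(\lambda d)\big)$, i.e. both are $\tilde O(dM^2)$. -/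

import Mathlib

open MeasureTheory

noncomputable section

namespace FedLinUCB

/-- Vectors of `ℝ^d` with the Euclidean norm. -/
abbrev Vec (d : ℕ) : Type := EuclideanSpace ℝ (Fin d)

/-- Real `d × d` matrices. -/
abbrev Mat (d : ℕ) : Type := Matrix (Fin d) (Fin d) ℝ

/-- The rank-one matrix `x xᵀ`. -/
def outer {d : ℕ} (x : Vec d) : Mat d := Matrix.vecMulVec x.ofLp x.ofLp

/-- The matrix-vector product `A x`. -/
def apply {d : ℕ} (A : Mat d) (x : Vec d) : Vec d := WithLp.toLp 2 (A.mulVec x.ofLp)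

/-- The weighted norm `‖x‖_A = √(xᵀ A x)`. -/
def wnorm {d : ℕ} (A : Mat d) (x : Vec d) : ℝ := Real.sqrt (inner ℝ x (apply A x))

/-- The data held by the `M` agents and by the server between two rounds. -/
structure State (M d : ℕ) where
  /-- covariance matrix last downloaded by each agent -/
  cov : Fin M → Mat d
  /-- reward vector last downloaded by each agent -/
  vec : Fin M → Vec d
  /-- each agent's current estimate of the unknown parameter -/
  est : Fin M → Vec d
  /-- local (not yet uploaded) covariance matrix of each agent -/
  covLoc : Fin M → Mat d
  /-- local (not yet uploaded) reward vector of each agent -/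
  vecLoc : Fin M → Vec d
  /-- covariance matrix at the server -/
  covSer : Mat d
  /-- reward vector at the server -/
  vecSer : Vec d

/-- Initialization with regularization parameter `lam`. -/
def init (M d : ℕ) (lam : ℝ) : State M d where
  cov := fun _ => lam • (1 : Mat d)
  vec := fun _ => 0
  est := fun _ => 0
  covLoc := fun _ => 0
  vecLoc := fun _ => 0
  covSer := lam • (1 : Mat d)
  vecSer := 0

/-- Determinant criterion for the active agent `m` that has just played `x`:
its local matrix, with `x xᵀ` included, raises the determinant of its covariance matrix by more
than the factor `1 + α`. -/
def Triggers {M d : ℕ} (α : ℝ) (s : State M d) (m : Fin M) (x : Vec d) : Prop :=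
  (1 + α) * (s.cov m).det < (s.cov m + (s.covLoc m + outer x)).det

/-- The local update of the active agent `m` (action `x`, reward `r`). -/
def localUpdate {M d : ℕ} (s : State M d) (m : Fin M) (x : Vec d) (r : ℝ) : State M d :=
  { s with
    covLoc := Function.update s.covLoc m (s.covLoc m + outer x)
    vecLoc := Function.update s.vecLoc m (s.vecLoc m + r • x) }

/-- Agent `m` uploads its local data, the server adds them to its own, the agent's local data are
reset, and the agent downloads the server's data and recomputes its estimate. -/
def communicate {M d : ℕ} (s : State M d) (m : Fin M) : State M d where
  cov := Function.update s.cov m (s.covSer + s.covLoc m)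
  vec := Function.update s.vec m (s.vecSer + s.vecLoc m)
  est := Function.update s.est m (apply (s.covSer + s.covLoc m)⁻¹ (s.vecSer + s.vecLoc m))
  covLoc := Function.update s.covLoc m 0
  vecLoc := Function.update s.vecLoc m 0
  covSer := s.covSer + s.covLoc m
  vecSer := s.vecSer + s.vecLoc m

open Classical in
/-- One round: agent `m` is active, plays `x` and receives the reward `r`. -/
def step {M d : ℕ} (α : ℝ) (s : State M d) (m : Fin M) (x : Vec d) (r : ℝ) : State M d :=
  if Triggers α s m x then communicate (localUpdate s m x r) m else localUpdate s m x r

/-- The state before round `t` (rounds are numbered from `0`), along the sequences of active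
agents, actions and rewards. -/
def state {M d : ℕ} (α lam : ℝ) (m : ℕ → Fin M) (x : ℕ → Vec d) (r : ℕ → ℝ) : ℕ → State M d
  | 0 => init M d lam
  | t + 1 => step α (state α lam m x r t) (m t) (x t) (r t)

/-- The optimistic index that agent `m` assigns to the action `y`. -/
def ucb {M d : ℕ} (β : ℝ) (s : State M d) (m : Fin M) (y : Vec d) : ℝ :=
  inner ℝ (s.est m) y + β * wnorm (s.cov m)⁻¹ y

/-- During the first `T` rounds the actions are those of FedLinUCB: in each round the active agent
plays an action of the decision set that maximizes its optimistic index. -/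
def IsRun {M d : ℕ} (α β lam : ℝ) (T : ℕ) (D : ℕ → Set (Vec d))
    (m : ℕ → Fin M) (x : ℕ → Vec d) (r : ℕ → ℝ) : Prop :=
  ∀ t < T, x t ∈ D t ∧
    ∀ y ∈ D t, ucb β (state α lam m x r t) (m t) y ≤ ucb β (state α lam m x r t) (m t) (x t)

open Classical in
/-- Communication complexity of the first `T` rounds: a round in which the criterion is met costs
one upload and one download; no other round communicates. -/
def commComplexity {M d : ℕ} (α lam : ℝ) (T : ℕ)
    (m : ℕ → Fin M) (x : ℕ → Vec d) (r : ℕ → ℝ) : ℕ :=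
  ∑ t ∈ Finset.range T, if Triggers α (state α lam m x r t) (m t) (x t) then 2 else 0

open Classical in
/-- Switching cost of the first `T` rounds: the number of pairs (round, agent) such that the data
that define the agent's decision rule change in that round. -/
def switchingCost {M d : ℕ} (α lam : ℝ) (T : ℕ)
    (m : ℕ → Fin M) (x : ℕ → Vec d) (r : ℕ → ℝ) : ℕ :=
  ∑ t ∈ Finset.range T, (Finset.univ.filter (fun k : Fin M =>
    ((state α lam m x r (t + 1)).est k, (state α lam m x r (t + 1)).cov k) ≠
      ((state α lam m x r t).est k, (state α lam m x r t).cov k))).card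

/-- Cumulative regret of the first `T` rounds. -/
def regret {d : ℕ} (θ : Vec d) (T : ℕ) (D : ℕ → Set (Vec d)) (x : ℕ → Vec d) : ℝ :=
  ∑ t ∈ Finset.range T, (sSup ((fun y => inner ℝ y θ) '' D t) - inner ℝ (x t) θ)

/-- The σ-algebra generated by the actions and the active agents up to and including round `t` and
by the rewards of the rounds before `t`. -/
@[reducible]
def history {Ω : Type*} {M d : ℕ} (m : ℕ → Ω → Fin M) (x : ℕ → Ω → Vec d) (r : ℕ → Ω → ℝ)
    (t : ℕ) : MeasurableSpace Ω :=
  (⨆ i ∈ Finset.range (t + 1),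
      MeasurableSpace.comap (x i) inferInstance ⊔ MeasurableSpace.comap (m i) inferInstance) ⊔
    ⨆ i ∈ Finset.range t, MeasurableSpace.comap (r i) inferInstance

/-- `η` is `R`-sub-Gaussian conditionally on the σ-algebra `F`. -/
def CondSubGaussian {Ω : Type*} [MeasurableSpace Ω] (μ : Measure Ω) (F : MeasurableSpace Ω)
    (η : Ω → ℝ) (R : ℝ) : Prop :=
  ∀ s : ℝ, Integrable (fun ω => Real.exp (s * η ω)) μ ∧
    ∀ᵐ ω ∂μ, condExp F μ (fun ω' => Real.exp (s * η ω')) ω ≤ Real.exp (R ^ 2 * s ^ 2 / 2)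

end FedLinUCB

end

/-!
# Regret, communication and switching cost of FedLinUCB

All matrices of a run arise from `λ I` by adding rank-one matrices `x xᵀ`; the predicate `IsGram`
and a few facts about `det` and inverses under rank-one updates carry the linear algebra. The key
one is `det_add_add`: adding `C` raises `det (A + B)` at least as much as it raises `det A`.

**Communication.** When agent `m` communicates, let `e ^ l` be the factor by which the server's
determinant exceeds that of the matrix the agent last downloaded, and `e ^ g` the factor by which
the server's determinant grows in this round. Superadditivity turns the criterion into
`1 + α e ^ (-l) ≤ e ^ g`, hence `1 ≤ (l + g) + g / α` (`one_le_lag_add_gain`). The numbers `l + g`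
telescope over the communications of one agent and the numbers `g` over all of them, and both sums
are at most the total growth `G` of the log-determinant. So there are at most `(M + 1 / α) G`
communications (`trigCount_le`), and a decision rule changes only in a round with a communication.

**Regret given confidence.** Suppose every agent's confidence ellipsoid contains `θ`. In rounds
without communication the criterion bounds the squared widths of one agent between two
communications by `α` in total, hence by `α (M + (M + 1 / α) G)` in the whole run. In a
communication round the width can be large because the agent is outdated; the cost of that round is
at most `2 S L (l + g) + 2 β √g` (`cost_le_lag_add_gain`), and the sums telescope again
(`regret_le_of_confidence`).

**Confidence.** The server holds the noise of all rounds minus what the agents hold back, and the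
latter is normalized by matrices that are at most `2 α` times the server's (`server_confidence`).
Each of these noise terms is controlled by the method of mixtures; for the data held back by an
agent the mixing covariance is tied to `α` times its current matrix, so that the log-determinant
term is at most `1`. No union over time or agents is needed: the mixtures of all batches of held
back data ever started, at most `M + (M + 1 / α) G`, together with the mixture of the whole run form
one nonnegative supermartingale (`capital`), to which Ville's inequality is applied once. The
stakes leave the failure probability at `δ` because the regret bound is trivially true unless
`T L² / λ` is so large that the number of batches is small compared with `T L² / (min α 1 · λ)`
(`constants_of_nontrivial`).
-/

namespace FedLinUCB

open Matrix
open scoped ENNReal NNReal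

/-! ### Rank-one updates, determinants and inverses -/

section Linear

variable {n : Type*}

/-- `C` is a finite sum of rank-one matrices `v vᵀ`. -/
inductive IsGram : Matrix n n ℝ → Prop
  | zero : IsGram 0
  | add_outer {C : Matrix n n ℝ} (v : n → ℝ) : IsGram C → IsGram (C + vecMulVec v v)

theorem IsGram.add {B C : Matrix n n ℝ} (hB : IsGram B) (hC : IsGram C) : IsGram (B + C) := by
  induction hC with
  | zero => simpa using hB
  | add_outer v _ ih => rw [← add_assoc]; exact ih.add_outer v

variable [Fintype n]

theorem posSemidef_outer (v : n → ℝ) : (vecMulVec v v).PosSemidef := by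
  simpa using posSemidef_vecMulVec_self_star v

theorem IsGram.posSemidef {C : Matrix n n ℝ} (hC : IsGram C) : C.PosSemidef := by
  induction hC with
  | zero => exact PosSemidef.zero
  | add_outer v _ ih => exact ih.add (posSemidef_outer v)

theorem quad_nonneg {A : Matrix n n ℝ} (hA : A.PosSemidef) (v : n → ℝ) : 0 ≤ v ⬝ᵥ A *ᵥ v := by
  simpa using hA.dotProduct_mulVec_nonneg v

theorem bilin_comm {A : Matrix n n ℝ} (hA : A.IsHermitian) (u v : n → ℝ) :
    u ⬝ᵥ A *ᵥ v = v ⬝ᵥ A *ᵥ u := by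
  have h : Aᵀ = A := by simpa [IsHermitian, conjTranspose_eq_transpose_of_trivial] using hA
  rw [dotProduct_comm, ← h, mulVec_transpose, ← dotProduct_mulVec, h]

theorem outer_mulVec (v u : n → ℝ) : vecMulVec v v *ᵥ u = (v ⬝ᵥ u) • v := by
  ext i; simp [vecMulVec_mulVec, mul_comm]

theorem quad_outer (u v : n → ℝ) : u ⬝ᵥ vecMulVec v v *ᵥ u = (v ⬝ᵥ u) ^ 2 := by
  rw [outer_mulVec, dotProduct_smul, smul_eq_mul, dotProduct_comm u v, sq]

theorem bilin_sq_le {A : Matrix n n ℝ} (hA : A.PosSemidef) (u v : n → ℝ) :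
    (u ⬝ᵥ A *ᵥ v) ^ 2 ≤ (u ⬝ᵥ A *ᵥ u) * (v ⬝ᵥ A *ᵥ v) := by
  have key : ∀ t : ℝ, 0 ≤ (v ⬝ᵥ A *ᵥ v) * (t * t) + (2 * (u ⬝ᵥ A *ᵥ v)) * t + u ⬝ᵥ A *ᵥ u := by
    intro t
    have := quad_nonneg hA (u + t • v)
    simp only [mulVec_add, mulVec_smul, dotProduct_add, add_dotProduct, smul_dotProduct,
      dotProduct_smul, smul_eq_mul, bilin_comm hA.isHermitian v u] at this
    linarith
  have := discrim_le_zero key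
  unfold discrim at this
  nlinarith

theorem trace_mul_outer (A : Matrix n n ℝ) (v : n → ℝ) :
    (A * vecMulVec v v).trace = v ⬝ᵥ A *ᵥ v := by
  rw [mul_vecMulVec, trace_vecMulVec, dotProduct_comm]

theorem _root_.Matrix.PosDef.add_gram {A C : Matrix n n ℝ} (hA : A.PosDef) (hC : IsGram C) :
    (A + C).PosDef := hA.add_posSemidef hC.posSemidef

theorem _root_.Matrix.PosDef.add_outer {A : Matrix n n ℝ} (hA : A.PosDef) (v : n → ℝ) :
    (A + vecMulVec v v).PosDef := hA.add_posSemidef (posSemidef_outer v)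

variable [DecidableEq n]

theorem quad_inv_nonneg {A : Matrix n n ℝ} (hA : A.PosDef) (v : n → ℝ) :
    0 ≤ v ⬝ᵥ A⁻¹ *ᵥ v := quad_nonneg hA.inv.posSemidef v

theorem mulVec_inv_mulVec {A : Matrix n n ℝ} (hA : A.PosDef) (v : n → ℝ) :
    A *ᵥ A⁻¹ *ᵥ v = v := by
  rw [mulVec_mulVec, mul_nonsing_inv _ (isUnit_iff_ne_zero.mpr hA.det_pos.ne'), one_mulVec]

theorem inv_mulVec_mulVec {A : Matrix n n ℝ} (hA : A.PosDef) (v : n → ℝ) :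
    A⁻¹ *ᵥ A *ᵥ v = v := by
  rw [mulVec_mulVec, nonsing_inv_mul _ (isUnit_iff_ne_zero.mpr hA.det_pos.ne'), one_mulVec]

/-- The Cauchy–Schwarz inequality for a norm `‖·‖_A` and its dual `‖·‖_{A⁻¹}`. -/
theorem dot_sq_le {A : Matrix n n ℝ} (hA : A.PosDef) (u v : n → ℝ) :
    (u ⬝ᵥ v) ^ 2 ≤ (u ⬝ᵥ A *ᵥ u) * (v ⬝ᵥ A⁻¹ *ᵥ v) := by
  have := bilin_sq_le hA.posSemidef u (A⁻¹ *ᵥ v)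
  rwa [mulVec_inv_mulVec hA, dotProduct_comm (A⁻¹ *ᵥ v)] at this

/-- Inversion reverses the Loewner order, up to the factor `c`. -/
theorem quad_inv_le {A B : Matrix n n ℝ} (hA : A.PosDef) (hB : B.PosDef) {c : ℝ}
    (h : ∀ u, u ⬝ᵥ A *ᵥ u ≤ c * (u ⬝ᵥ B *ᵥ u)) (s : n → ℝ) :
    s ⬝ᵥ B⁻¹ *ᵥ s ≤ c * (s ⬝ᵥ A⁻¹ *ᵥ s) := by
  have h1 := dot_sq_le hA (B⁻¹ *ᵥ s) s
  have h2 := h (B⁻¹ *ᵥ s)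
  rw [mulVec_inv_mulVec hB, dotProduct_comm _ s] at h2
  rw [dotProduct_comm _ s] at h1
  have hb := quad_inv_nonneg hB s
  have ha := quad_inv_nonneg hA s
  rcases hb.eq_or_lt with h0 | h0
  · rw [← h0] at h2 ⊢
    by_cases hs : s = 0
    · simp [hs]
    · have := hB.inv.dotProduct_mulVec_pos hs
      simp only [star_trivial] at this
      linarith
  · have : (s ⬝ᵥ B⁻¹ *ᵥ s) * (s ⬝ᵥ B⁻¹ *ᵥ s) ≤ (c * (s ⬝ᵥ A⁻¹ *ᵥ s)) * (s ⬝ᵥ B⁻¹ *ᵥ s) := by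
      nlinarith [mul_le_mul_of_nonneg_right h2 ha]
    exact le_of_mul_le_mul_right this h0

theorem det_add_outer {A : Matrix n n ℝ} (hA : A.PosDef) (v : n → ℝ) :
    (A + vecMulVec v v).det = A.det * (1 + v ⬝ᵥ A⁻¹ *ᵥ v) := by
  have h := det_add_replicateCol_mul_replicateRow (ι := Unit) (A := A)
    (isUnit_iff_ne_zero.mpr hA.det_pos.ne') v v
  rw [← vecMulVec_eq] at h
  rw [h]
  congr 1
  rw [det_unique]
  simp [Matrix.mul_assoc, Matrix.mul_apply, dotProduct, mulVec, Finset.mul_sum]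

theorem inv_add_outer_mulVec {A : Matrix n n ℝ} (hA : A.PosDef) (v w : n → ℝ) :
    (A + vecMulVec v v)⁻¹ *ᵥ w =
      A⁻¹ *ᵥ w - ((v ⬝ᵥ A⁻¹ *ᵥ w) / (1 + v ⬝ᵥ A⁻¹ *ᵥ v)) • A⁻¹ *ᵥ v := by
  have hq := quad_inv_nonneg hA v
  have hAv := hA.add_outer v
  have : (A + vecMulVec v v) *ᵥ
      (A⁻¹ *ᵥ w - ((v ⬝ᵥ A⁻¹ *ᵥ w) / (1 + v ⬝ᵥ A⁻¹ *ᵥ v)) • A⁻¹ *ᵥ v) = w := by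
    simp only [mulVec_sub, add_mulVec, mulVec_smul, mulVec_inv_mulVec hA, outer_mulVec]
    ext i
    simp only [Pi.add_apply, Pi.sub_apply, Pi.smul_apply, smul_eq_mul]
    field_simp
    ring
  conv_lhs => rw [← this]
  rw [inv_mulVec_mulVec hAv]

theorem bilin_inv_add_outer {A : Matrix n n ℝ} (hA : A.PosDef) (v u w : n → ℝ) :
    u ⬝ᵥ (A + vecMulVec v v)⁻¹ *ᵥ w =
      u ⬝ᵥ A⁻¹ *ᵥ w - (v ⬝ᵥ A⁻¹ *ᵥ u) * (v ⬝ᵥ A⁻¹ *ᵥ w) / (1 + v ⬝ᵥ A⁻¹ *ᵥ v) := by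
  rw [inv_add_outer_mulVec hA, dotProduct_sub, dotProduct_smul, smul_eq_mul,
    bilin_comm hA.inv.isHermitian u v]
  ring

theorem quad_inv_add_gram_le {A B : Matrix n n ℝ} (hA : A.PosDef) (hB : IsGram B) (v : n → ℝ) :
    v ⬝ᵥ (A + B)⁻¹ *ᵥ v ≤ v ⬝ᵥ A⁻¹ *ᵥ v := by
  have := quad_inv_le hA (hA.add_gram hB) (c := 1) (fun u => by
    rw [add_mulVec, dotProduct_add]; linarith [quad_nonneg hB.posSemidef u]) v
  linarith

/-- `vᵀ adj(A) v`, the determinant gained by adding `v vᵀ`, is monotone in `A`. -/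
theorem det_mul_quad_mono {A B : Matrix n n ℝ} (hA : A.PosDef) (hB : IsGram B) (v : n → ℝ) :
    A.det * (v ⬝ᵥ A⁻¹ *ᵥ v) ≤ (A + B).det * (v ⬝ᵥ (A + B)⁻¹ *ᵥ v) := by
  induction hB with
  | zero => simp
  | @add_outer C w hC ih =>
    refine ih.trans ?_
    have hAC := hA.add_gram hC
    rw [← add_assoc, det_add_outer hAC, bilin_inv_add_outer hAC, mul_assoc]
    refine mul_le_mul_of_nonneg_left ?_ hAC.det_pos.le
    have hw := quad_inv_nonneg hAC w
    have hcs := bilin_sq_le hAC.inv.posSemidef w v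
    have : (1 + w ⬝ᵥ (A + C)⁻¹ *ᵥ w) * (v ⬝ᵥ (A + C)⁻¹ *ᵥ v -
        (w ⬝ᵥ (A + C)⁻¹ *ᵥ v) * (w ⬝ᵥ (A + C)⁻¹ *ᵥ v) / (1 + w ⬝ᵥ (A + C)⁻¹ *ᵥ w)) =
        (1 + w ⬝ᵥ (A + C)⁻¹ *ᵥ w) * (v ⬝ᵥ (A + C)⁻¹ *ᵥ v) - (w ⬝ᵥ (A + C)⁻¹ *ᵥ v) ^ 2 := by
      field_simp
    rw [this]
    linarith

/-- Adding `C` raises the determinant of the larger matrix `A + B` at least as much as that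
of `A`. -/
theorem det_add_add {A B C : Matrix n n ℝ} (hA : A.PosDef) (hB : IsGram B) (hC : IsGram C) :
    (A + B).det + (A + C).det ≤ (A + B + C).det + A.det := by
  induction hC with
  | zero => simp
  | @add_outer C v hC ih =>
    have h := det_mul_quad_mono (hA.add_gram hC) hB v
    rw [add_right_comm A C B] at h
    rw [← add_assoc, ← add_assoc, det_add_outer (hA.add_gram hC),
      det_add_outer ((hA.add_gram hB).add_gram hC)]
    linarith

theorem one_add_trace_le {A C : Matrix n n ℝ} (hA : A.PosDef) (hC : IsGram C) :
    A.det * (1 + (A⁻¹ * C).trace) ≤ (A + C).det := by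
  induction hC with
  | zero => simp
  | @add_outer C v hC ih =>
    rw [← add_assoc, det_add_outer (hA.add_gram hC), Matrix.mul_add, trace_add, trace_mul_outer]
    linarith [det_mul_quad_mono hA hC v]

theorem trace_inv_mul_nonneg {A C : Matrix n n ℝ} (hA : A.PosDef) (hC : IsGram C) :
    0 ≤ (A⁻¹ * C).trace := by
  induction hC with
  | zero => simp
  | @add_outer C v hC ih =>
    rw [Matrix.mul_add, trace_add, trace_mul_outer]
    linarith [quad_inv_nonneg hA v]

theorem det_le_det_add {A C : Matrix n n ℝ} (hA : A.PosDef) (hC : IsGram C) :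
    A.det ≤ (A + C).det :=
  (le_mul_of_one_le_right hA.det_pos.le (by linarith [trace_inv_mul_nonneg hA hC])).trans
    (one_add_trace_le hA hC)

theorem det_add_le_exp_trace {A C : Matrix n n ℝ} (hA : A.PosDef) (hC : IsGram C) :
    (A + C).det ≤ A.det * Real.exp (A⁻¹ * C).trace := by
  induction hC with
  | zero => simp
  | @add_outer C v hC ih =>
    rw [← add_assoc, det_add_outer (hA.add_gram hC), Matrix.mul_add, trace_add, trace_mul_outer,
      Real.exp_add, ← mul_assoc]
    refine mul_le_mul ih ?_ (by linarith [quad_inv_nonneg (hA.add_gram hC) v])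
      (mul_nonneg hA.det_pos.le (Real.exp_pos _).le)
    linarith [quad_inv_add_gram_le hA hC v, Real.add_one_le_exp (v ⬝ᵥ A⁻¹ *ᵥ v)]

theorem quad_le_trace_mul {A C : Matrix n n ℝ} (hA : A.PosDef) (hC : IsGram C) (u : n → ℝ) :
    u ⬝ᵥ C *ᵥ u ≤ (A⁻¹ * C).trace * (u ⬝ᵥ A *ᵥ u) := by
  induction hC with
  | zero => simp
  | @add_outer C v hC ih =>
    rw [add_mulVec, dotProduct_add, quad_outer, Matrix.mul_add, trace_add, trace_mul_outer,
      dotProduct_comm v u]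
    linarith [dot_sq_le hA u v]

theorem det_le_trace_pow {A : Matrix n n ℝ} (hA : A.PosDef) [Nonempty n] :
    A.det ≤ (A.trace / Fintype.card n) ^ Fintype.card n := by
  have hz : ∀ i ∈ Finset.univ, 0 ≤ hA.isHermitian.eigenvalues i :=
    fun i _ => (hA.eigenvalues_pos i).le
  have hd : (0 : ℝ) < Fintype.card n := by exact_mod_cast Fintype.card_pos
  have h := Real.geom_mean_le_arith_mean Finset.univ (fun _ => 1) hA.isHermitian.eigenvalues
    (fun _ _ => zero_le_one) (by simpa using hd) hz
  simp only [Real.rpow_one, one_mul, Finset.sum_const, Finset.card_univ, nsmul_eq_mul,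
    mul_one] at h
  rw [hA.isHermitian.det_eq_prod_eigenvalues, hA.isHermitian.trace_eq_sum_eigenvalues]
  have hprod := Finset.prod_nonneg hz
  have := pow_le_pow_left₀ (Real.rpow_nonneg hprod _) h (Fintype.card n)
  rwa [← Real.rpow_natCast, ← Real.rpow_mul hprod, inv_mul_cancel₀ hd.ne', Real.rpow_one] at this

end Linear

/-! ### Weighted norms -/

section WeightedNorm

variable {n : Type*} [Fintype n]

/-- The seminorm `√(vᵀ A v)` on coordinate vectors, for `A` positive semidefinite. -/
noncomputable def qnorm (A : Matrix n n ℝ) (v : n → ℝ) : ℝ := √(v ⬝ᵥ A *ᵥ v)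

theorem qnorm_nonneg (A : Matrix n n ℝ) (v : n → ℝ) : 0 ≤ qnorm A v := Real.sqrt_nonneg _

theorem qnorm_zero (A : Matrix n n ℝ) : qnorm A 0 = 0 := by simp [qnorm]

theorem qnorm_neg (A : Matrix n n ℝ) (v : n → ℝ) : qnorm A (-v) = qnorm A v := by
  simp [qnorm, mulVec_neg]

theorem qnorm_add_le {A : Matrix n n ℝ} (hA : A.PosSemidef) (u v : n → ℝ) :
    qnorm A (u + v) ≤ qnorm A u + qnorm A v := by
  have hu := quad_nonneg hA u
  have hv := quad_nonneg hA v
  have hcs : u ⬝ᵥ A *ᵥ v ≤ qnorm A u * qnorm A v := by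
    rw [qnorm, qnorm, ← Real.sqrt_mul hu]
    exact Real.le_sqrt_of_sq_le (bilin_sq_le hA u v)
  refine Real.sqrt_le_iff.mpr ⟨add_nonneg (qnorm_nonneg _ _) (qnorm_nonneg _ _), ?_⟩
  have h1 : qnorm A u ^ 2 = u ⬝ᵥ A *ᵥ u := Real.sq_sqrt hu
  have h2 : qnorm A v ^ 2 = v ⬝ᵥ A *ᵥ v := Real.sq_sqrt hv
  simp only [mulVec_add, dotProduct_add, add_dotProduct, bilin_comm hA.isHermitian v u]
  nlinarith

theorem qnorm_sub_le {A : Matrix n n ℝ} (hA : A.PosSemidef) (u v : n → ℝ) :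
    qnorm A (u - v) ≤ qnorm A u + qnorm A v := by
  simpa [sub_eq_add_neg, qnorm_neg] using qnorm_add_le hA u (-v)

theorem qnorm_sum_le {A : Matrix n n ℝ} (hA : A.PosSemidef) {ι : Type*} (s : Finset ι)
    (f : ι → n → ℝ) : qnorm A (∑ i ∈ s, f i) ≤ ∑ i ∈ s, qnorm A (f i) :=
  Finset.le_sum_of_subadditive _ (qnorm_zero A).le (qnorm_add_le hA) s f

end WeightedNorm

/-! ### The matrices of a run -/

section Run

variable {M d : ℕ}

theorem inner_eq_dotProduct (x y : Vec d) : inner ℝ x y = x.ofLp ⬝ᵥ y.ofLp := by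
  rw [EuclideanSpace.inner_eq_star_dotProduct, star_trivial, dotProduct_comm]

theorem wnorm_eq_qnorm (A : Mat d) (x : Vec d) : wnorm A x = qnorm A x.ofLp := by
  rw [wnorm, qnorm, inner_eq_dotProduct, apply]

theorem posDef_smul_one {lam : ℝ} (hlam : 0 < lam) : (lam • (1 : Mat d)).PosDef :=
  PosDef.one.smul hlam

theorem posDef_of_gram_sub {lam : ℝ} (hlam : 0 < lam) {A : Mat d}
    (h : IsGram (A - lam • (1 : Mat d))) : A.PosDef := by
  simpa using (posDef_smul_one hlam).add_gram h

/-- The invariant that every round preserves: up to sums of rank-one matrices the server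
dominates each agent and each agent dominates the regularizer, and the local data of an agent are
small relative to its downloaded matrix (this is where the communication criterion enters). -/
structure Valid (α lam : ℝ) (s : State M d) : Prop where
  cov_gram : ∀ k, IsGram (s.cov k - lam • (1 : Mat d))
  covSer_gram : IsGram (s.covSer - lam • (1 : Mat d))
  gap_gram : ∀ k, IsGram (s.covSer - s.cov k)
  loc_gram : ∀ k, IsGram (s.covLoc k)
  loc_trace : ∀ k, ((s.cov k)⁻¹ * s.covLoc k).trace ≤ α

theorem step_of_not_triggers {α : ℝ} {s : State M d} {m : Fin M} {x : Vec d} (r : ℝ)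
    (h : ¬ Triggers α s m x) : step α s m x r = localUpdate s m x r := if_neg h

theorem step_of_triggers {α : ℝ} {s : State M d} {m : Fin M} {x : Vec d} (r : ℝ)
    (h : Triggers α s m x) : step α s m x r =
      { cov := Function.update s.cov m (s.covSer + (s.covLoc m + outer x))
        vec := Function.update s.vec m (s.vecSer + (s.vecLoc m + r • x))
        est := Function.update s.est m (apply (s.covSer + (s.covLoc m + outer x))⁻¹
          (s.vecSer + (s.vecLoc m + r • x)))
        covLoc := Function.update s.covLoc m 0
        vecLoc := Function.update s.vecLoc m 0
        covSer := s.covSer + (s.covLoc m + outer x)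
        vecSer := s.vecSer + (s.vecLoc m + r • x) } := by
  rw [step, if_pos h, communicate, localUpdate]
  simp

variable {α lam : ℝ} {s : State M d}

theorem Valid.cov_posDef (hs : Valid α lam s) (hlam : 0 < lam) (k : Fin M) : (s.cov k).PosDef :=
  posDef_of_gram_sub hlam (hs.cov_gram k)

theorem Valid.covSer_posDef (hs : Valid α lam s) (hlam : 0 < lam) : s.covSer.PosDef :=
  posDef_of_gram_sub hlam hs.covSer_gram

theorem Valid.loc_add_gram (hs : Valid α lam s) (m : Fin M) (x : Vec d) :
    IsGram (s.covLoc m + outer x) := (hs.loc_gram m).add_outer x.ofLp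

theorem valid_init (hα : 0 < α) : Valid α lam (init M d lam) where
  cov_gram k := by simpa [init] using IsGram.zero
  covSer_gram := by simpa [init] using IsGram.zero
  gap_gram k := by simpa [init] using IsGram.zero
  loc_gram k := IsGram.zero
  loc_trace k := by simpa [init] using hα.le

theorem Valid.loc_trace_of_not_triggers (hs : Valid α lam s) (hlam : 0 < lam) {m : Fin M}
    {x : Vec d} (h : ¬ Triggers α s m x) :
    ((s.cov m)⁻¹ * (s.covLoc m + outer x)).trace ≤ α := by
  have hA := hs.cov_posDef hlam m
  have h1 := one_add_trace_le hA (hs.loc_add_gram m x)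
  have h2 := h1.trans (not_lt.mp h)
  rw [mul_comm (1 + α)] at h2
  linarith [le_of_mul_le_mul_left h2 hA.det_pos]

theorem Valid.step (hs : Valid α lam s) (hα : 0 < α) (hlam : 0 < lam) (m : Fin M) (x : Vec d)
    (r : ℝ) : Valid α lam (step α s m x r) := by
  by_cases h : Triggers α s m x
  · rw [step_of_triggers r h]
    have hC := hs.loc_add_gram m x
    have hser : IsGram (s.covSer + (s.covLoc m + outer x) - lam • (1 : Mat d)) := by
      rw [add_sub_right_comm]; exact hs.covSer_gram.add hC
    refine ⟨fun k => ?_, hser, fun k => ?_, fun k => ?_, fun k => ?_⟩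
    all_goals rcases eq_or_ne k m with rfl | hk
    · simpa using hser
    · simpa [hk] using hs.cov_gram k
    · simpa using IsGram.zero
    · simp only [ne_eq, hk, not_false_eq_true, Function.update_of_ne]
      rw [add_sub_right_comm]; exact (hs.gap_gram k).add hC
    · simpa using IsGram.zero
    · simpa [hk] using hs.loc_gram k
    · simpa using hα.le
    · simpa [hk] using hs.loc_trace k
  · rw [step_of_not_triggers r h]
    refine ⟨hs.cov_gram, hs.covSer_gram, hs.gap_gram, fun k => ?_, fun k => ?_⟩
    all_goals rcases eq_or_ne k m with rfl | hk
    · simpa [localUpdate] using hs.loc_add_gram k x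
    · simpa [localUpdate, hk] using hs.loc_gram k
    · simpa [localUpdate] using hs.loc_trace_of_not_triggers hlam h
    · simpa [localUpdate, hk] using hs.loc_trace k

/-! ### The determinant gained by a communication -/

/-- A communication multiplies the determinant at the server by `e ^ g`. If the server has moved
ahead of the agent by the factor `e ^ l`, the gain seen by the agent, a factor `1 + q`, is diluted
by at most that factor. -/
theorem Valid.exp_gain (hs : Valid α lam s) (hlam : 0 < lam) {m : Fin M} {C : Mat d}
    (hC : IsGram C) {q : ℝ} (hq : (s.cov m).det * (1 + q) ≤ (s.cov m + C).det) :
    1 + q * Real.exp (-(Real.log s.covSer.det - Real.log (s.cov m).det)) ≤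
      Real.exp (Real.log (s.covSer + C).det - Real.log s.covSer.det) := by
  have hA := (hs.cov_posDef hlam m).det_pos
  have hS := (hs.covSer_posDef hlam).det_pos
  have hSC := ((hs.covSer_posDef hlam).add_gram hC).det_pos
  have h := det_add_add (hs.cov_posDef hlam m) (hs.gap_gram m) hC
  rw [add_sub_cancel] at h
  rw [neg_sub, Real.exp_sub, Real.exp_sub, Real.exp_log hA, Real.exp_log hS, Real.exp_log hSC,
    le_div_iff₀ hS]
  have : (1 + q * ((s.cov m).det / s.covSer.det)) * s.covSer.det =
      s.covSer.det + q * (s.cov m).det := by field_simp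
  rw [this]
  linarith

theorem Valid.lag_nonneg (hs : Valid α lam s) (hlam : 0 < lam) (k : Fin M) :
    Real.log (s.cov k).det ≤ Real.log s.covSer.det := by
  refine Real.log_le_log (hs.cov_posDef hlam k).det_pos ?_
  simpa using det_le_det_add (hs.cov_posDef hlam k) (hs.gap_gram k)

theorem Valid.gain_nonneg (hs : Valid α lam s) (hlam : 0 < lam) {C : Mat d} (hC : IsGram C) :
    Real.log s.covSer.det ≤ Real.log (s.covSer + C).det :=
  Real.log_le_log (hs.covSer_posDef hlam).det_pos (det_le_det_add (hs.covSer_posDef hlam) hC)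

/-- With lag `l` and gain `g`, every communication pays one unit of the potential in which the
agents' log-determinants have weight `1` and the server's has weight `1 / α`. -/
theorem one_le_lag_add_gain {α l g : ℝ} (hα : 0 < α)
    (h : 1 + α * Real.exp (-l) ≤ Real.exp g) : 1 ≤ l + g + g / α := by
  have hα1 : 0 < 1 + α := by linarith
  set c := Real.log (1 + α) with hc
  have hec : Real.exp (-c) = (1 + α)⁻¹ := by rw [Real.exp_neg, Real.exp_log hα1]
  -- tangents of `exp (-·)` at the worst case `l = 0`, `g = log (1 + α)`
  have htan : ∀ z, (1 + α)⁻¹ * (1 - (z - c)) ≤ Real.exp (-z) := by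
    intro z
    have := Real.add_one_le_exp (-(z - c))
    calc (1 + α)⁻¹ * (1 - (z - c)) ≤ (1 + α)⁻¹ * Real.exp (-(z - c)) :=
          mul_le_mul_of_nonneg_left (by linarith) (by positivity)
      _ = Real.exp (-z) := by rw [← hec, ← Real.exp_add]; ring_nf
  have h1 : Real.exp (-g) + α * Real.exp (-(l + g)) ≤ 1 := by
    have := mul_le_mul_of_nonneg_right h (Real.exp_pos (-g)).le
    rw [← Real.exp_add, add_neg_cancel, Real.exp_zero, add_mul, one_mul, mul_assoc,
      ← Real.exp_add] at this
    rwa [neg_add]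
  have h2 := htan g
  have h3 := mul_le_mul_of_nonneg_left (htan (l + g)) hα.le
  have h4 : (1 + α)⁻¹ * ((1 - (g - c)) + α * (1 - (l + g - c))) ≤ 1 := by linarith
  rw [inv_mul_le_iff₀ hα1] at h4
  have h5 := Real.one_sub_inv_le_log_of_pos hα1
  have h6 : (1 + α) * (1 - (1 + α)⁻¹) = α := by field_simp; ring
  have h7 := mul_le_mul_of_nonneg_left h5 hα1.le
  rw [h6] at h7
  have h8 : α * 1 ≤ α * (l + g + g / α) := by
    have : α * (l + g + g / α) = α * (l + g) + g := by field_simp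
    rw [this]
    linarith
  exact le_of_mul_le_mul_left h8 hα

/-- A cost bounded both by `a` and by `b √q` is paid by lag and gain at rate `a` and by the
square root of the gain at rate `b`. -/
theorem cost_le_lag_add_gain {a b c l g q : ℝ} (ha : 0 ≤ a) (hb : 0 ≤ b) (hl : 0 ≤ l)
    (hg : 0 ≤ g) (hq : 0 ≤ q) (h : 1 + q * Real.exp (-l) ≤ Real.exp g) (hca : c ≤ a)
    (hcb : c ≤ b * √q) : c ≤ a * (l + g) + b * √g := by
  rcases le_or_gt 1 (l + g) with hk | hk
  · nlinarith [mul_nonneg hb (Real.sqrt_nonneg g)]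
  · have h1 : q ≤ Real.exp (l + g) * g := by
      have h2 : Real.exp l + q ≤ Real.exp (l + g) := by
        have := mul_le_mul_of_nonneg_left h (Real.exp_pos l).le
        rwa [mul_add, mul_one, mul_left_comm, ← Real.exp_add, add_neg_cancel, Real.exp_zero,
          mul_one, ← Real.exp_add] at this
      have h3 : Real.exp l = Real.exp (l + g) * Real.exp (-g) := by
        rw [← Real.exp_add]; ring_nf
      nlinarith [Real.exp_pos (l + g), Real.add_one_le_exp (-g)]
    have h4 : (1 - (l + g)) * Real.exp (l + g) ≤ 1 := by
      have := mul_le_mul_of_nonneg_right (Real.add_one_le_exp (-(l + g)))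
        (Real.exp_pos (l + g)).le
      rw [← Real.exp_add, neg_add_cancel, Real.exp_zero] at this
      linarith
    have hk0 : 0 ≤ 1 - (l + g) := by linarith
    have h5 : (1 - (l + g)) * √q ≤ √g := by
      refine Real.le_sqrt_of_sq_le ?_
      rw [mul_pow, Real.sq_sqrt hq]
      have h6 : (1 - (l + g)) ^ 2 * q ≤ (1 - (l + g)) ^ 2 * (Real.exp (l + g) * g) :=
        mul_le_mul_of_nonneg_left h1 (sq_nonneg _)
      have h7 : (1 - (l + g)) ^ 2 * (Real.exp (l + g) * g) =
          (1 - (l + g)) * (((1 - (l + g)) * Real.exp (l + g)) * g) := by ring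
      have h8 : ((1 - (l + g)) * Real.exp (l + g)) * g ≤ 1 * g :=
        mul_le_mul_of_nonneg_right h4 hg
      nlinarith
    have hsplit : c = (l + g) * c + (1 - (l + g)) * c := by ring
    have h9 : (l + g) * c ≤ (l + g) * a := mul_le_mul_of_nonneg_left hca (by linarith)
    have h10 : (1 - (l + g)) * c ≤ (1 - (l + g)) * (b * √q) :=
      mul_le_mul_of_nonneg_left hcb hk0
    have h11 := mul_le_mul_of_nonneg_left h5 hb
    nlinarith

end Run

/-! ### Totals along a run and the number of communications -/

section Totals

variable {M d : ℕ} {α lam : ℝ} {m : ℕ → Fin M} {x : ℕ → Vec d} {r : ℕ → ℝ}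

theorem valid_state (hα : 0 < α) (hlam : 0 < lam) (t : ℕ) : Valid α lam (state α lam m x r t) := by
  induction t with
  | zero => exact valid_init hα
  | succ t ih => exact ih.step hα hlam _ _ _

open Classical in
/-- The number of communication rounds among the first `t` rounds. -/
noncomputable def trigCount (α lam : ℝ) (m : ℕ → Fin M) (x : ℕ → Vec d) (r : ℕ → ℝ) (t : ℕ) : ℝ :=
  ∑ i ∈ Finset.range t, if Triggers α (state α lam m x r i) (m i) (x i) then 1 else 0

/-- The regularized covariance matrix of all actions of the first `t` rounds. -/
noncomputable def totalCov (lam : ℝ) (x : ℕ → Vec d) (t : ℕ) : Mat d :=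
  lam • (1 : Mat d) + ∑ i ∈ Finset.range t, outer (x i)

/-- The sum of all actions of the first `t` rounds, weighted with their noise. -/
noncomputable def noiseSum (θ : Vec d) (x : ℕ → Vec d) (r : ℕ → ℝ) (t : ℕ) : Fin d → ℝ :=
  ∑ i ∈ Finset.range t, (r i - inner ℝ (x i) θ) • (x i).ofLp

/-- The part of agent `k`'s local reward vector that is due to the noise. -/
noncomputable def locNoise (θ : Vec d) (s : State M d) (k : Fin M) : Fin d → ℝ :=
  (s.vecLoc k).ofLp - s.covLoc k *ᵥ θ.ofLp

theorem totalCov_succ (t : ℕ) : totalCov lam x (t + 1) = totalCov lam x t + outer (x t) := by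
  rw [totalCov, Finset.sum_range_succ, ← add_assoc, totalCov]

theorem totalCov_gram (t : ℕ) : IsGram (totalCov lam x t - lam • (1 : Mat d)) := by
  induction t with
  | zero => simpa [totalCov] using IsGram.zero
  | succ t ih => rw [totalCov_succ, add_sub_right_comm]; exact ih.add_outer _

theorem totalCov_posDef (hlam : 0 < lam) (t : ℕ) : (totalCov lam x t).PosDef :=
  posDef_of_gram_sub hlam (totalCov_gram t)

theorem sum_update_add {ι E : Type*} [Fintype ι] [DecidableEq ι] [AddCommGroup E] (f : ι → E)
    (k : ι) (v : E) : ∑ i, Function.update f k v i = ∑ i, f i - f k + v := by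
  rw [Finset.sum_update_of_mem (Finset.mem_univ k), Finset.sdiff_singleton_eq_erase,
    Finset.sum_erase_eq_sub (Finset.mem_univ k)]
  abel

theorem covSer_add_sum (t : ℕ) : (state α lam m x r t).covSer +
    ∑ k, (state α lam m x r t).covLoc k = totalCov lam x t := by
  induction t with
  | zero => simp [state, init, totalCov]
  | succ t ih =>
    rw [totalCov_succ, ← ih, state]
    by_cases h : Triggers α (state α lam m x r t) (m t) (x t)
    · rw [step_of_triggers _ h]
      simp only [sum_update_add]
      abel
    · rw [step_of_not_triggers _ h]
      simp only [localUpdate, sum_update_add]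
      abel

theorem vecSer_add_sum (t : ℕ) : (state α lam m x r t).vecSer +
    ∑ k, (state α lam m x r t).vecLoc k = ∑ i ∈ Finset.range t, r i • x i := by
  induction t with
  | zero => simp [state, init]
  | succ t ih =>
    rw [Finset.sum_range_succ, ← ih, state]
    by_cases h : Triggers α (state α lam m x r t) (m t) (x t)
    · rw [step_of_triggers _ h]
      simp only [sum_update_add]
      abel
    · rw [step_of_not_triggers _ h]
      simp only [localUpdate, sum_update_add]
      abel

theorem outer_mulVec_ofLp (x θ : Vec d) : outer x *ᵥ θ.ofLp = (inner ℝ x θ : ℝ) • x.ofLp := by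
  rw [outer, outer_mulVec, inner_eq_dotProduct]

theorem sum_ofLp {ι : Type*} (s : Finset ι) (f : ι → Vec d) :
    (∑ i ∈ s, f i).ofLp = ∑ i ∈ s, (f i).ofLp := by
  ext j; simp

/-- The server has all the noise except for what the agents hold back. -/
theorem server_noise (θ : Vec d) (t : ℕ) : (state α lam m x r t).vecSer.ofLp -
    ((state α lam m x r t).covSer - lam • (1 : Mat d)) *ᵥ θ.ofLp =
      noiseSum θ x r t - ∑ k, locNoise θ (state α lam m x r t) k := by
  have h1 := covSer_add_sum (α := α) (lam := lam) (m := m) (x := x) (r := r) t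
  have h2 := vecSer_add_sum (α := α) (lam := lam) (m := m) (x := x) (r := r) t
  rw [eq_sub_of_add_eq h1, eq_sub_of_add_eq h2, totalCov]
  simp only [noiseSum, locNoise, sub_smul, Finset.sum_sub_distrib, WithLp.ofLp_sub, sum_ofLp,
    WithLp.ofLp_smul, sub_mulVec, add_mulVec, sum_mulVec, outer_mulVec_ofLp]
  abel

/-! ### The communication bound -/

theorem step_cov_of_not_triggers {s : State M d} {k : Fin M} {y : Vec d} (ρ : ℝ)
    (h : ¬ Triggers α s k y) : (step α s k y ρ).cov = s.cov ∧ (step α s k y ρ).est = s.est ∧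
      (step α s k y ρ).covSer = s.covSer := by
  rw [step_of_not_triggers _ h]; exact ⟨rfl, rfl, rfl⟩

open Classical in
theorem trigCount_le_potential (hα : 0 < α) (hlam : 0 < lam) (t : ℕ) :
    trigCount α lam m x r t ≤
      ∑ k, (Real.log ((state α lam m x r t).cov k).det - Real.log (lam • (1 : Mat d)).det) +
        (Real.log (state α lam m x r t).covSer.det - Real.log (lam • (1 : Mat d)).det) / α := by
  induction t with
  | zero => simp [trigCount, state, init]
  | succ t ih =>
    rw [trigCount, Finset.sum_range_succ, ← trigCount, state]
    have hs := valid_state (α := α) (lam := lam) (m := m) (x := x) (r := r) hα hlam t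
    by_cases h : Triggers α (state α lam m x r t) (m t) (x t)
    · rw [step_of_triggers _ h, if_pos h]
      have hC := hs.loc_add_gram (m t) (x t)
      have hq := h.le
      rw [mul_comm] at hq
      have h1 := one_le_lag_add_gain hα (hs.exp_gain hlam hC hq)
      simp only [Finset.sum_sub_distrib] at ih ⊢
      have h2 : ∀ A : Mat d, ∑ k, Real.log (Function.update (state α lam m x r t).cov (m t) A k).det
          = ∑ k, Real.log ((state α lam m x r t).cov k).det
            - Real.log ((state α lam m x r t).cov (m t)).det + Real.log A.det := by
        intro A
        rw [← sum_update_add (fun k => Real.log ((state α lam m x r t).cov k).det)]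
        refine Finset.sum_congr rfl fun k _ => ?_
        rcases eq_or_ne k (m t) with rfl | hk
        · simp
        · simp [hk]
      rw [h2]
      rw [sub_div] at h1 ih ⊢
      linarith
    · rw [if_neg h, add_zero]
      obtain ⟨h1, -, h3⟩ := step_cov_of_not_triggers (r t) h
      rw [h1, h3]
      exact ih

theorem sum_log_cov_le (hα : 0 < α) (hlam : 0 < lam) (t : ℕ) :
    ∑ k, (Real.log ((state α lam m x r t).cov k).det - Real.log (lam • (1 : Mat d)).det) ≤
      M * (Real.log (state α lam m x r t).covSer.det - Real.log (lam • (1 : Mat d)).det) := by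
  have hs := valid_state (α := α) (lam := lam) (m := m) (x := x) (r := r) hα hlam t
  refine (Finset.sum_le_sum fun k _ => sub_le_sub_right (hs.lag_nonneg hlam k) _).trans ?_
  rw [Finset.sum_const, Finset.card_univ, Fintype.card_fin, nsmul_eq_mul]

theorem trigCount_le (hα : 0 < α) (hlam : 0 < lam) (t : ℕ) :
    trigCount α lam m x r t ≤ (M + 1 / α) *
      (Real.log (state α lam m x r t).covSer.det - Real.log (lam • (1 : Mat d)).det) := by
  refine (trigCount_le_potential hα hlam t).trans ?_
  have := sum_log_cov_le (m := m) (x := x) (r := r) hα hlam t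
  rw [add_mul, one_div, inv_mul_eq_div]
  linarith

theorem log_covSer_le_totalCov (hα : 0 < α) (hlam : 0 < lam) (t : ℕ) :
    Real.log (state α lam m x r t).covSer.det ≤ Real.log (totalCov lam x t).det := by
  have hs := valid_state (α := α) (lam := lam) (m := m) (x := x) (r := r) hα hlam t
  rw [← covSer_add_sum (α := α) (m := m) (r := r) t]
  refine hs.gain_nonneg hlam (Finset.sum_induction _ IsGram (fun _ _ => IsGram.add) IsGram.zero ?_)
  exact fun k _ => hs.loc_gram k

theorem trace_totalCov_le {L : ℝ} {t : ℕ} (hx : ∀ i < t, ‖x i‖ ≤ L) :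
    (totalCov lam x t).trace ≤ lam * d + t * L ^ 2 := by
  rw [totalCov, trace_add, trace_smul, trace_one, trace_sum, Fintype.card_fin, smul_eq_mul]
  have : ∀ i ∈ Finset.range t, (outer (x i)).trace ≤ L ^ 2 := by
    intro i hi
    rw [outer, trace_vecMulVec, ← inner_eq_dotProduct, real_inner_self_eq_norm_sq]
    exact pow_le_pow_left₀ (norm_nonneg _) (hx i (Finset.mem_range.mp hi)) 2
  have := Finset.sum_le_sum this
  simp only [Finset.sum_const, Finset.card_range, nsmul_eq_mul] at this
  linarith

/-- The growth of the log-determinant, `d log (1 + T L² / (λ d))`. -/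
theorem log_totalCov_sub_le {L : ℝ} {t T : ℕ} (hlam : 0 < lam) (htT : t ≤ T)
    (hx : ∀ i < t, ‖x i‖ ≤ L) :
    Real.log (totalCov lam x t).det - Real.log (lam • (1 : Mat d)).det ≤
      d * Real.log (1 + T * L ^ 2 / (lam * d)) := by
  rcases Nat.eq_zero_or_pos d with rfl | hd
  · simp
  have : Nonempty (Fin d) := ⟨⟨0, hd⟩⟩
  have hd' : (0 : ℝ) < d := by exact_mod_cast hd
  have hV := totalCov_posDef (x := x) hlam t
  have hI := (posDef_smul_one (d := d) hlam).det_pos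
  rw [← Real.log_div hV.det_pos.ne' hI.ne', ← Real.log_pow]
  refine Real.log_le_log (div_pos hV.det_pos hI) ?_
  have h1 := det_le_trace_pow hV
  rw [Fintype.card_fin] at h1
  rw [div_le_iff₀ hI, det_smul, det_one, mul_one, Fintype.card_fin, ← mul_pow]
  refine h1.trans (pow_le_pow_left₀ ?_ ?_ d)
  · exact div_nonneg (PosSemidef.trace_nonneg hV.posSemidef) hd'.le
  · have h2 := trace_totalCov_le (lam := lam) hx
    have h3 : (t : ℝ) * L ^ 2 ≤ T * L ^ 2 :=
      mul_le_mul_of_nonneg_right (by exact_mod_cast htT) (sq_nonneg L)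
    rw [div_le_iff₀ hd']
    have h4 : (1 + T * L ^ 2 / (lam * d)) * lam * d = lam * d + T * L ^ 2 := by
      field_simp
    linarith

theorem trigCount_le_log {L : ℝ} {t T : ℕ} (hα : 0 < α) (hlam : 0 < lam) (htT : t ≤ T)
    (hx : ∀ i < t, ‖x i‖ ≤ L) :
    trigCount α lam m x r t ≤ (M + 1 / α) * (d * Real.log (1 + T * L ^ 2 / (lam * d))) := by
  refine (trigCount_le hα hlam t).trans (mul_le_mul_of_nonneg_left ?_ (by positivity))
  have := log_covSer_le_totalCov (m := m) (x := x) (r := r) hα hlam t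
  linarith [log_totalCov_sub_le hlam htT hx]

theorem commComplexity_eq (T : ℕ) :
    (commComplexity α lam T m x r : ℝ) = 2 * trigCount α lam m x r T := by
  rw [commComplexity, trigCount, Finset.mul_sum]
  push_cast
  exact Finset.sum_congr rfl fun i _ => by split_ifs <;> norm_num

theorem switchingCost_le (T : ℕ) :
    (switchingCost α lam T m x r : ℝ) ≤ trigCount α lam m x r T := by
  classical
  rw [switchingCost, trigCount]
  push_cast
  refine Finset.sum_le_sum fun t _ => ?_
  rw [state]
  by_cases h : Triggers α (state α lam m x r t) (m t) (x t)
  · rw [if_pos h, step_of_triggers _ h]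
    rw [← Nat.cast_one, Nat.cast_le, ← Finset.card_singleton (m t)]
    refine Finset.card_le_card fun k hk => ?_
    by_contra hne
    rw [Finset.mem_singleton] at hne
    exact (Finset.mem_filter.mp hk).2 (by simp [hne])
  · rw [if_neg h]
    obtain ⟨h1, h2, -⟩ := step_cov_of_not_triggers (r t) h
    simp [h1, h2]

end Totals

/-! ### Confidence ellipsoids from bounds on the noise -/

section Confidence

variable {M d : ℕ} {α lam : ℝ} {m : ℕ → Fin M} {x : ℕ → Vec d} {r : ℕ → ℝ}

theorem qnorm_inv_le {n : Type*} [Fintype n] [DecidableEq n] {A B : Matrix n n ℝ}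
    (hA : A.PosDef) (hB : B.PosDef) {c : ℝ} (hc : 0 ≤ c)
    (h : ∀ u, u ⬝ᵥ A *ᵥ u ≤ c * (u ⬝ᵥ B *ᵥ u)) (s : n → ℝ) :
    qnorm B⁻¹ s ≤ √c * qnorm A⁻¹ s := by
  rw [qnorm, qnorm, ← Real.sqrt_mul hc]
  exact Real.sqrt_le_sqrt (quad_inv_le hA hB h s)

theorem abs_dot_le_qnorm {n : Type*} [Fintype n] [DecidableEq n] {A : Matrix n n ℝ}
    (hA : A.PosDef) (u v : n → ℝ) : |u ⬝ᵥ v| ≤ qnorm A u * qnorm A⁻¹ v := by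
  rw [qnorm, qnorm, ← Real.sqrt_mul (quad_nonneg hA.posSemidef u)]
  exact Real.abs_le_sqrt (dot_sq_le hA u v)

theorem qnorm_smul_one (hlam : 0 ≤ lam) (θ : Vec d) :
    qnorm (lam • (1 : Mat d)) θ.ofLp = √lam * ‖θ‖ := by
  rw [qnorm, smul_mulVec, one_mulVec, dotProduct_smul, smul_eq_mul, ← inner_eq_dotProduct,
    real_inner_self_eq_norm_sq, Real.sqrt_mul hlam, Real.sqrt_sq (norm_nonneg _)]

/-- The bias of ridge regression. -/
theorem qnorm_inv_smul_le (hlam : 0 < lam) {A : Mat d} (hA : IsGram (A - lam • (1 : Mat d)))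
    (θ : Vec d) : qnorm A⁻¹ (lam • θ.ofLp) ≤ √lam * ‖θ‖ := by
  have hI := posDef_smul_one (d := d) hlam
  have h := qnorm_inv_le hI (posDef_of_gram_sub hlam hA) zero_le_one (fun u => by
    have := quad_nonneg hA.posSemidef u
    rw [sub_mulVec, dotProduct_sub] at this
    linarith) (lam • θ.ofLp)
  have h1 : lam • θ.ofLp = (lam • (1 : Mat d)) *ᵥ θ.ofLp := by rw [smul_mulVec, one_mulVec]
  have h2 : qnorm (lam • (1 : Mat d))⁻¹ (lam • θ.ofLp) = qnorm (lam • (1 : Mat d)) θ.ofLp := by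
    rw [h1, qnorm, inv_mulVec_mulVec hI, dotProduct_comm, qnorm]
  rwa [Real.sqrt_one, one_mul, h2, qnorm_smul_one hlam.le] at h

variable {s : State M d}

theorem Valid.quad_cov_le (hs : Valid α lam s) (k : Fin M) (u : Fin d → ℝ) :
    u ⬝ᵥ s.cov k *ᵥ u ≤ u ⬝ᵥ s.covSer *ᵥ u := by
  have := quad_nonneg (hs.gap_gram k).posSemidef u
  rw [sub_mulVec, dotProduct_sub] at this
  linarith

theorem Valid.quad_loc_le (hs : Valid α lam s) (hlam : 0 < lam) (k : Fin M)
    (u : Fin d → ℝ) : u ⬝ᵥ s.covLoc k *ᵥ u ≤ α * (u ⬝ᵥ s.cov k *ᵥ u) :=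
  (quad_le_trace_mul (hs.cov_posDef hlam k) (hs.loc_gram k) u).trans
    (mul_le_mul_of_nonneg_right (hs.loc_trace k)
      (quad_nonneg (hs.cov_posDef hlam k).posSemidef u))

/-- The matrix that normalizes the noise held back by agent `k`. -/
def locCov (α : ℝ) (s : State M d) (k : Fin M) : Mat d := α • s.cov k + s.covLoc k

theorem Valid.locCov_posDef (hs : Valid α lam s) (hα : 0 < α) (hlam : 0 < lam) (k : Fin M) :
    (locCov α s k).PosDef := ((hs.cov_posDef hlam k).smul hα).add_gram (hs.loc_gram k)

/-- The noise `N` of the whole run and the noises `N_k` held back by the agents control the error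
of the server's ridge estimate. The data held back are at most `α` times the server's, hence the
factors `√(1 + M α)` and `√(2 α)`. -/
theorem server_confidence (hα : 0 < α) (hlam : 0 < lam) (θ : Vec d) {S ρ : ℝ} (hθ : ‖θ‖ ≤ S)
    (t : ℕ) (hall : qnorm (totalCov lam x t)⁻¹ (noiseSum θ x r t) ≤ ρ)
    (hloc : ∀ k, qnorm (locCov α (state α lam m x r t) k)⁻¹
      (locNoise θ (state α lam m x r t) k) ≤ ρ) :
    qnorm (state α lam m x r t).covSer
      ((apply (state α lam m x r t).covSer⁻¹ (state α lam m x r t).vecSer).ofLp - θ.ofLp) ≤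
      √lam * S + (√(1 + M * α) + M * √(2 * α)) * ρ := by
  have hs := valid_state (α := α) (lam := lam) (m := m) (x := x) (r := r) hα hlam t
  have hnoise := server_noise (α := α) (lam := lam) (m := m) (x := x) (r := r) θ t
  have htot := covSer_add_sum (α := α) (lam := lam) (m := m) (x := x) (r := r) t
  set s := state α lam m x r t
  have hA := hs.covSer_posDef hlam
  have hA' := hA.inv.posSemidef
  have herr : (apply s.covSer⁻¹ s.vecSer).ofLp - θ.ofLp =
      s.covSer⁻¹ *ᵥ ((noiseSum θ x r t - ∑ k, locNoise θ s k) - lam • θ.ofLp) := by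
    rw [← hnoise, sub_mulVec, smul_mulVec, one_mulVec, ← sub_add, add_sub_cancel_right,
      mulVec_sub, inv_mulVec_mulVec hA, apply]
  have hdual : ∀ v, qnorm s.covSer (s.covSer⁻¹ *ᵥ v) = qnorm s.covSer⁻¹ v := by
    intro v
    rw [qnorm, mulVec_inv_mulVec hA, dotProduct_comm, qnorm]
  have h1 : qnorm s.covSer⁻¹ (noiseSum θ x r t) ≤ √(1 + M * α) * ρ := by
    refine (qnorm_inv_le (totalCov_posDef (x := x) hlam t) hA (c := 1 + M * α) (by positivity)
      (fun u => ?_) _).trans (mul_le_mul_of_nonneg_left hall (Real.sqrt_nonneg _))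
    rw [← htot, add_mulVec, dotProduct_add, sum_mulVec, dotProduct_sum]
    have : ∀ k ∈ Finset.univ, u ⬝ᵥ s.covLoc k *ᵥ u ≤ α * (u ⬝ᵥ s.covSer *ᵥ u) := fun k _ =>
      (hs.quad_loc_le hlam k u).trans (mul_le_mul_of_nonneg_left (hs.quad_cov_le k u) hα.le)
    have := Finset.sum_le_sum this
    rw [Finset.sum_const, Finset.card_univ, Fintype.card_fin, nsmul_eq_mul] at this
    linarith
  have h2 : ∀ k ∈ Finset.univ, qnorm s.covSer⁻¹ (locNoise θ s k) ≤ √(2 * α) * ρ := by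
    intro k _
    refine (qnorm_inv_le (hs.locCov_posDef hα hlam k) hA (c := 2 * α) (by positivity)
      (fun u => ?_) _).trans (mul_le_mul_of_nonneg_left (hloc k) (Real.sqrt_nonneg _))
    rw [locCov, add_mulVec, smul_mulVec, dotProduct_add, dotProduct_smul, smul_eq_mul]
    linarith [hs.quad_loc_le hlam k u, mul_le_mul_of_nonneg_left (hs.quad_cov_le k u) hα.le]
  have h3 := Finset.sum_le_sum h2
  rw [Finset.sum_const, Finset.card_univ, Fintype.card_fin, nsmul_eq_mul] at h3
  have h4 := (qnorm_inv_smul_le hlam hs.covSer_gram θ).trans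
    (mul_le_mul_of_nonneg_left hθ (Real.sqrt_nonneg lam))
  rw [herr, hdual]
  linarith [qnorm_sub_le hA' (noiseSum θ x r t - ∑ k, locNoise θ s k) (lam • θ.ofLp),
    qnorm_sub_le hA' (noiseSum θ x r t) (∑ k, locNoise θ s k),
    qnorm_sum_le hA' Finset.univ (locNoise θ s)]

theorem agent_confidence (hα : 0 < α) (hlam : 0 < lam) (θ : Vec d) {S ρ : ℝ} (hθ : ‖θ‖ ≤ S)
    (hρ : 0 ≤ ρ) {T : ℕ} (hall : ∀ t ≤ T, qnorm (totalCov lam x t)⁻¹ (noiseSum θ x r t) ≤ ρ)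
    (hloc : ∀ t ≤ T, ∀ k, qnorm (locCov α (state α lam m x r t) k)⁻¹
      (locNoise θ (state α lam m x r t) k) ≤ ρ) {t : ℕ} (ht : t ≤ T) (k : Fin M) :
    qnorm ((state α lam m x r t).cov k) (((state α lam m x r t).est k).ofLp - θ.ofLp) ≤
      √lam * S + (√(1 + M * α) + M * √(2 * α)) * ρ := by
  induction t with
  | zero =>
    have h1 : qnorm ((state α lam m x r 0).cov k) (((state α lam m x r 0).est k).ofLp - θ.ofLp) =
        √lam * ‖θ‖ := by
      rw [← qnorm_smul_one hlam.le, ← qnorm_neg]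
      simp [state, init]
    rw [h1]
    have := mul_le_mul_of_nonneg_left hθ (Real.sqrt_nonneg lam)
    have : 0 ≤ (√(1 + M * α) + M * √(2 * α)) * ρ := by positivity
    linarith
  | succ t ih =>
    have hserver := server_confidence hα hlam θ hθ (t + 1) (hall _ ht) (hloc _ ht)
    have ih := ih (Nat.le_of_succ_le ht)
    rw [state] at hserver ⊢
    by_cases h : Triggers α (state α lam m x r t) (m t) (x t)
    · rw [step_of_triggers _ h] at hserver ⊢
      rcases eq_or_ne k (m t) with rfl | hk
      · simpa using hserver
      · simpa [hk] using ih
    · obtain ⟨h1, h2, -⟩ := step_cov_of_not_triggers (r t) h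
      rw [h1, h2]
      exact ih

/-! ### The regret of optimistic actions -/

theorem optimistic_regret_le {β : ℝ} {θ : Vec d} {s : State M d} {k : Fin M} {D : Set (Vec d)}
    {a : Vec d} (hA : (s.cov k).PosDef)
    (hconf : qnorm (s.cov k) ((s.est k).ofLp - θ.ofLp) ≤ β) (ha : a ∈ D)
    (hmax : ∀ y ∈ D, ucb β s k y ≤ ucb β s k a) :
    sSup ((fun y => inner ℝ y θ) '' D) - inner ℝ a θ ≤ 2 * β * qnorm (s.cov k)⁻¹ a.ofLp := by
  have key : ∀ y : Vec d, |inner ℝ (s.est k) y - inner ℝ y θ| ≤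
      β * qnorm (s.cov k)⁻¹ y.ofLp := by
    intro y
    rw [real_inner_comm θ y, ← inner_sub_left, inner_eq_dotProduct]
    exact (abs_dot_le_qnorm hA _ _).trans
      (mul_le_mul_of_nonneg_right hconf (qnorm_nonneg _ _))
  rw [sub_le_iff_le_add]
  refine csSup_le (Set.Nonempty.image _ ⟨a, ha⟩) ?_
  rintro _ ⟨y, hy, rfl⟩
  have h1 := hmax y hy
  rw [ucb, ucb, wnorm_eq_qnorm, wnorm_eq_qnorm] at h1
  have h2 := abs_le.mp (key y)
  have h3 := abs_le.mp (key a)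
  show inner ℝ y θ ≤ _
  linarith

theorem regret_term_le {S L : ℝ} {θ : Vec d} {D : Set (Vec d)} {a : Vec d} (hθ : ‖θ‖ ≤ S)
    (hD : ∀ y ∈ D, ‖y‖ ≤ L) (ha : a ∈ D) :
    sSup ((fun y => inner ℝ y θ) '' D) - inner ℝ a θ ≤ 2 * S * L := by
  have key : ∀ y ∈ D, |inner ℝ y θ| ≤ S * L := by
    intro y hy
    refine (abs_real_inner_le_norm y θ).trans ?_
    rw [mul_comm]
    exact mul_le_mul hθ (hD y hy) (norm_nonneg _) ((norm_nonneg _).trans hθ)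
  rw [sub_le_iff_le_add]
  refine csSup_le (Set.Nonempty.image _ ⟨a, ha⟩) ?_
  rintro _ ⟨y, hy, rfl⟩
  have h2 := abs_le.mp (key y hy)
  have h3 := abs_le.mp (key a ha)
  show inner ℝ y θ ≤ _
  linarith

open Classical in
/-- The squared width charged to round `t`: the gain of the server's log-determinant in a
communication round, and the squared norm of the action in any other round. -/
noncomputable def width (α lam : ℝ) (m : ℕ → Fin M) (x : ℕ → Vec d) (r : ℕ → ℝ) (t : ℕ) : ℝ :=
  if Triggers α (state α lam m x r t) (m t) (x t) then
    Real.log (state α lam m x r (t + 1)).covSer.det - Real.log (state α lam m x r t).covSer.det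
  else (x t).ofLp ⬝ᵥ ((state α lam m x r t).cov (m t))⁻¹ *ᵥ (x t).ofLp

theorem width_nonneg (hα : 0 < α) (hlam : 0 < lam) (t : ℕ) : 0 ≤ width α lam m x r t := by
  have hs := valid_state (α := α) (lam := lam) (m := m) (x := x) (r := r) hα hlam t
  rw [width]
  split_ifs with h
  · rw [state, step_of_triggers _ h]
    exact sub_nonneg.mpr (hs.gain_nonneg hlam (hs.loc_add_gram _ _))
  · exact quad_inv_nonneg (hs.cov_posDef hlam _) _

/-- Between two communications the squared widths of an agent sum to at most `α`. -/
theorem sum_width_le (hα : 0 < α) (hlam : 0 < lam) (t : ℕ) :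
    ∑ i ∈ Finset.range t, width α lam m x r i ≤
      (Real.log (state α lam m x r t).covSer.det - Real.log (lam • (1 : Mat d)).det) +
      α * (M + trigCount α lam m x r t) := by
  have hpot : ∑ i ∈ Finset.range t, width α lam m x r i ≤
      (Real.log (state α lam m x r t).covSer.det - Real.log (lam • (1 : Mat d)).det) +
      (∑ k, (((state α lam m x r t).cov k)⁻¹ * (state α lam m x r t).covLoc k).trace +
        α * trigCount α lam m x r t) := by
    induction t with
    | zero => simp [trigCount, state, init]
    | succ t ih =>
      have hs := valid_state (α := α) (lam := lam) (m := m) (x := x) (r := r) hα hlam t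
      rw [trigCount, Finset.sum_range_succ, Finset.sum_range_succ, ← trigCount, width]
      by_cases h : Triggers α (state α lam m x r t) (m t) (x t)
      · rw [if_pos h, if_pos h, state, step_of_triggers _ h]
        have h2 : ∀ A : Mat d, ∑ k, ((Function.update (state α lam m x r t).cov (m t) A k)⁻¹ *
            Function.update (state α lam m x r t).covLoc (m t) 0 k).trace =
            ∑ k, (((state α lam m x r t).cov k)⁻¹ * (state α lam m x r t).covLoc k).trace -
            (((state α lam m x r t).cov (m t))⁻¹ * (state α lam m x r t).covLoc (m t)).trace
              + 0 := by
          intro A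
          rw [← sum_update_add]
          refine Finset.sum_congr rfl fun k _ => ?_
          rcases eq_or_ne k (m t) with rfl | hk
          · simp
          · simp [hk]
        rw [h2]
        linarith [hs.loc_trace (m t)]
      · rw [if_neg h, if_neg h, state, step_of_not_triggers _ h]
        simp only [localUpdate]
        have h2 : ∑ k, (((state α lam m x r t).cov k)⁻¹ *
            Function.update (state α lam m x r t).covLoc (m t)
              ((state α lam m x r t).covLoc (m t) + outer (x t)) k).trace =
            ∑ k, (((state α lam m x r t).cov k)⁻¹ * (state α lam m x r t).covLoc k).trace -
            (((state α lam m x r t).cov (m t))⁻¹ * (state α lam m x r t).covLoc (m t)).trace +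
            (((state α lam m x r t).cov (m t))⁻¹ *
              ((state α lam m x r t).covLoc (m t) + outer (x t))).trace := by
          rw [← sum_update_add]
          refine Finset.sum_congr rfl fun k _ => ?_
          rcases eq_or_ne k (m t) with rfl | hk
          · simp
          · simp [hk]
        rw [h2, Matrix.mul_add, trace_add, outer, trace_mul_outer]
        linarith
  have hs := valid_state (α := α) (lam := lam) (m := m) (x := x) (r := r) hα hlam t
  have := Finset.sum_le_sum (s := Finset.univ) (fun k _ => hs.loc_trace k)
  rw [Finset.sum_const, Finset.card_univ, Fintype.card_fin, nsmul_eq_mul] at this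
  linarith

/-- The rounds that communicate are charged to the growth of the agents' log-determinants at the
maximal rate `2 S L`, all rounds to their widths. -/
theorem regret_le_potential (hα : 0 < α) (hlam : 0 < lam) {β S L : ℝ} {θ : Vec d}
    {D : ℕ → Set (Vec d)} (hβ : 0 ≤ β) (hS : 0 ≤ S) (hL : 0 ≤ L) {t : ℕ}
    (hmin : ∀ i < t, sSup ((fun y => inner ℝ y θ) '' D i) - inner ℝ (x i) θ ≤ 2 * S * L)
    (hucb : ∀ i < t, sSup ((fun y => inner ℝ y θ) '' D i) - inner ℝ (x i) θ ≤
      2 * β * qnorm ((state α lam m x r i).cov (m i))⁻¹ (x i).ofLp) :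
    regret θ t D x ≤ 2 * S * L * ∑ k, (Real.log ((state α lam m x r t).cov k).det -
        Real.log (lam • (1 : Mat d)).det) +
      2 * β * ∑ i ∈ Finset.range t, √(width α lam m x r i) := by
  induction t with
  | zero => simp [regret, state, init]
  | succ t ih =>
    have ih := ih (fun i hi => hmin i (hi.trans t.lt_succ_self))
      (fun i hi => hucb i (hi.trans t.lt_succ_self))
    have h1 := hmin t t.lt_succ_self
    have h2 := hucb t t.lt_succ_self
    have hs := valid_state (α := α) (lam := lam) (m := m) (x := x) (r := r) hα hlam t
    rw [regret, Finset.sum_range_succ, Finset.sum_range_succ, ← regret, width]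
    by_cases h : Triggers α (state α lam m x r t) (m t) (x t)
    · rw [if_pos h, state, step_of_triggers _ h]
      have hC := hs.loc_add_gram (m t) (x t)
      have hq : ((state α lam m x r t).cov (m t)).det *
          (1 + (x t).ofLp ⬝ᵥ ((state α lam m x r t).cov (m t))⁻¹ *ᵥ (x t).ofLp) ≤
          ((state α lam m x r t).cov (m t) +
            ((state α lam m x r t).covLoc (m t) + outer (x t))).det := by
        have hA := hs.cov_posDef hlam (m t)
        rw [← det_add_outer hA, add_comm ((state α lam m x r t).covLoc (m t)), ← add_assoc]
        exact det_le_det_add (hA.add_outer _) (hs.loc_gram _)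
      have h3 := cost_le_lag_add_gain (by positivity) (by positivity)
        (sub_nonneg.mpr (hs.lag_nonneg hlam (m t))) (sub_nonneg.mpr (hs.gain_nonneg hlam hC))
        (quad_inv_nonneg (hs.cov_posDef hlam _) _) (hs.exp_gain hlam hC hq) h1 h2
      have h4 : ∀ A : Mat d, ∑ k, (Real.log (Function.update (state α lam m x r t).cov (m t) A
          k).det - Real.log (lam • (1 : Mat d)).det) = ∑ k, (Real.log
          ((state α lam m x r t).cov k).det - Real.log (lam • (1 : Mat d)).det) - (Real.log
          ((state α lam m x r t).cov (m t)).det - Real.log (lam • (1 : Mat d)).det) +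
          (Real.log A.det - Real.log (lam • (1 : Mat d)).det) := by
        intro A
        rw [← sum_update_add (fun k => Real.log ((state α lam m x r t).cov k).det -
          Real.log (lam • (1 : Mat d)).det)]
        refine Finset.sum_congr rfl fun k _ => ?_
        rcases eq_or_ne k (m t) with rfl | hk
        · simp
        · simp [hk]
      rw [h4]
      linarith
    · obtain ⟨h3, -, -⟩ := step_cov_of_not_triggers (r t) h
      rw [if_neg h, state, h3]
      rw [qnorm] at h2
      linarith

/-- The regret on the event that all confidence ellipsoids contain `θ`; `G` is any bound on the
growth of the server's log-determinant. -/
theorem regret_le_of_confidence (hα : 0 < α) (hlam : 0 < lam) {β S L G : ℝ} {θ : Vec d}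
    {D : ℕ → Set (Vec d)} {T : ℕ} (hβ : 0 ≤ β) (hL : 0 ≤ L) (hθ : ‖θ‖ ≤ S)
    (hD : ∀ t < T, ∀ y ∈ D t, ‖y‖ ≤ L) (hrun : IsRun α β lam T D m x r)
    (hconf : ∀ t < T, qnorm ((state α lam m x r t).cov (m t))
      (((state α lam m x r t).est (m t)).ofLp - θ.ofLp) ≤ β)
    (hG : Real.log (state α lam m x r T).covSer.det - Real.log (lam • (1 : Mat d)).det ≤ G) :
    regret θ T D x ≤ 2 * S * L * (M * G) + 2 * β * √(T * (M * α + (M * α + 2) * G)) := by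
  have hS : 0 ≤ S := (norm_nonneg _).trans hθ
  have h1 := regret_le_potential (r := r) (m := m) (D := D) hα hlam hβ hS hL (t := T)
    (fun i hi => regret_term_le hθ (hD i hi) (hrun i hi).1)
    (fun i hi => optimistic_regret_le ((valid_state hα hlam i).cov_posDef hlam _) (hconf i hi)
      (hrun i hi).1 (hrun i hi).2)
  have h2 := sum_log_cov_le (m := m) (x := x) (r := r) hα hlam T
  have h3 : ∑ i ∈ Finset.range T, √(width α lam m x r i) ≤
      √(T * (M * α + (M * α + 2) * G)) := by
    refine Real.le_sqrt_of_sq_le ?_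
    have h4 := sq_sum_le_card_mul_sum_sq (s := Finset.range T)
      (f := fun i => √(width α lam m x r i))
    simp only [Real.sq_sqrt (width_nonneg hα hlam _), Finset.card_range] at h4
    refine h4.trans (mul_le_mul_of_nonneg_left ?_ (Nat.cast_nonneg T))
    have h5 := sum_width_le (m := m) (x := x) (r := r) hα hlam T
    have h6 := (trigCount_le (m := m) (x := x) (r := r) hα hlam T).trans
      (mul_le_mul_of_nonneg_left hG (by positivity))
    have h7 := mul_le_mul_of_nonneg_left h6 hα.le
    have h8 : α * ((M + 1 / α) * G) = M * α * G + G := by field_simp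
    linarith
  have h9 : 2 * S * L * ∑ k, (Real.log ((state α lam m x r T).cov k).det -
      Real.log (lam • (1 : Mat d)).det) ≤ 2 * S * L * (M * G) :=
    mul_le_mul_of_nonneg_left (h2.trans (mul_le_mul_of_nonneg_left hG (Nat.cast_nonneg M)))
      (by positivity)
  have h10 := mul_le_mul_of_nonneg_left h3 (by positivity : 0 ≤ 2 * β)
  linarith

end Confidence

/-! ### A one-step inequality for Gaussian mixtures -/

section OneStep

variable {Ω : Type*} {F mΩ : MeasurableSpace Ω} {μ : Measure Ω} {η : Ω → ℝ} {R : ℝ}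

theorem CondSubGaussian.div_const (hR : 0 < R) (h : CondSubGaussian μ F η R) :
    CondSubGaussian μ F (fun ω => η ω / R) 1 := by
  intro s
  have h1 := h (s / R)
  have h2 : ∀ ω, s / R * η ω = s * (η ω / R) := fun ω => by ring
  have h3 : R ^ 2 * (s / R) ^ 2 / 2 = 1 ^ 2 * s ^ 2 / 2 := by field_simp
  simpa only [h2, h3] using h1

variable [IsProbabilityMeasure μ]

theorem CondSubGaussian.lintegral_mul_exp_le (hF : F ≤ mΩ) (hη : Measurable η)
    (h : CondSubGaussian μ F η R) {f : Ω → ℝ≥0∞} (hf : Measurable[F] f) (s : ℝ) :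
    ∫⁻ ω, f ω * ENNReal.ofReal (Real.exp (s * η ω)) ∂μ ≤
      ∫⁻ ω, f ω * ENNReal.ofReal (Real.exp (R ^ 2 * s ^ 2 / 2)) ∂μ := by
  obtain ⟨hint, hle⟩ := h s
  set e : Ω → ℝ≥0∞ := fun ω => ENNReal.ofReal (Real.exp (s * η ω)) with he
  set c := ENNReal.ofReal (Real.exp (R ^ 2 * s ^ 2 / 2)) with hc
  have hme : Measurable e := by fun_prop
  have hfm : Measurable f := hf.mono hF le_rfl
  have hset : ∀ B, MeasurableSet[F] B → ∫⁻ ω in B, e ω ∂μ ≤ c * μ B := by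
    intro B hB
    rw [he, ← ofReal_integral_eq_lintegral_ofReal hint.integrableOn
      (Filter.Eventually.of_forall fun _ => (Real.exp_pos _).le), ← setIntegral_condExp hF hint hB]
    have h1 : ∫ ω in B, condExp F μ (fun ω' => Real.exp (s * η ω')) ω ∂μ ≤
        ∫ _ in B, Real.exp (R ^ 2 * s ^ 2 / 2) ∂μ :=
      setIntegral_mono_ae integrable_condExp.integrableOn (integrable_const _).integrableOn hle
    refine (ENNReal.ofReal_le_ofReal h1).trans ?_
    rw [setIntegral_const, smul_eq_mul, mul_comm, ENNReal.ofReal_mul (Real.exp_pos _).le,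
      Measure.real, ENNReal.ofReal_toReal (measure_ne_top μ B)]
  have hmeas : (μ.withDensity e).trim hF ≤ (c • μ).trim hF := by
    refine Measure.le_iff.mpr fun B hB => ?_
    rw [trim_measurableSet_eq hF hB, trim_measurableSet_eq hF hB,
      withDensity_apply _ (hF _ hB), Measure.smul_apply, smul_eq_mul]
    exact hset B hB
  have h2 : ∫⁻ ω, f ω ∂(μ.withDensity e) ≤ ∫⁻ ω, f ω ∂(c • μ) := by
    rw [← lintegral_trim hF hf, ← lintegral_trim hF hf]
    exact lintegral_mono' hmeas le_rfl
  rw [lintegral_withDensity_eq_lintegral_mul _ hme hfm, lintegral_smul_measure] at h2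
  rw [lintegral_mul_const _ hfm, mul_comm _ c]
  simpa [mul_comm] using h2

/-- The mixture of `exp (s e - s ^ 2 / 2)` over `s` distributed as `N(b, a)`. -/
noncomputable def mix (a b e : ℝ) : ℝ :=
  Real.exp ((2 * e * b + e ^ 2 * a - b ^ 2) / (2 * (1 + a))) / √(1 + a)

theorem mix_nonneg (a b e : ℝ) : 0 ≤ mix a b e := by unfold mix; positivity

theorem gaussianPDFReal_mul_exp {a : ℝ} (ha : 0 < a) (b e s : ℝ) :
    ProbabilityTheory.gaussianPDFReal b a.toNNReal s * Real.exp (-(s ^ 2) / 2) *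
      Real.exp (s * e) =
    mix a b e * ProbabilityTheory.gaussianPDFReal ((b + a * e) / (1 + a))
      (a / (1 + a)).toNNReal s := by
  have h1 : 0 < 1 + a := by linarith
  rw [ProbabilityTheory.gaussianPDFReal, ProbabilityTheory.gaussianPDFReal, mix,
    Real.coe_toNNReal _ ha.le, Real.coe_toNNReal _ (by positivity)]
  have hs : √(2 * Real.pi * a) = √(1 + a) * √(2 * Real.pi * (a / (1 + a))) := by
    rw [← Real.sqrt_mul h1.le]
    congr 1
    field_simp
  have key : Real.exp (-(s - b) ^ 2 / (2 * a)) * Real.exp (-(s ^ 2) / 2) * Real.exp (s * e) =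
      Real.exp ((2 * e * b + e ^ 2 * a - b ^ 2) / (2 * (1 + a))) *
        Real.exp (-(s - (b + a * e) / (1 + a)) ^ 2 / (2 * (a / (1 + a)))) := by
    rw [← Real.exp_add, ← Real.exp_add, ← Real.exp_add]
    congr 1
    field_simp
    ring
  rw [hs, mul_inv]
  linear_combination ((√(1 + a))⁻¹ * (√(2 * Real.pi * (a / (1 + a))))⁻¹) * key

theorem lintegral_gaussian_mul_exp {a : ℝ} (ha : 0 < a) (b e : ℝ) :
    ∫⁻ s, ENNReal.ofReal (ProbabilityTheory.gaussianPDFReal b a.toNNReal s) *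
      ENNReal.ofReal (Real.exp (-(s ^ 2) / 2)) * ENNReal.ofReal (Real.exp (s * e)) =
    ENNReal.ofReal (mix a b e) := by
  have h : ∀ s, ENNReal.ofReal (ProbabilityTheory.gaussianPDFReal b a.toNNReal s) *
      ENNReal.ofReal (Real.exp (-(s ^ 2) / 2)) * ENNReal.ofReal (Real.exp (s * e)) =
      ENNReal.ofReal (mix a b e) * ENNReal.ofReal (ProbabilityTheory.gaussianPDFReal
        ((b + a * e) / (1 + a)) (a / (1 + a)).toNNReal s) := by
    intro s
    have hg := ProbabilityTheory.gaussianPDFReal_nonneg b a.toNNReal s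
    rw [← ENNReal.ofReal_mul hg, ← ENNReal.ofReal_mul (mul_nonneg hg (Real.exp_pos _).le),
      ← ENNReal.ofReal_mul (mix_nonneg a b e), gaussianPDFReal_mul_exp ha]
  simp_rw [h]
  rw [lintegral_const_mul' _ _ ENNReal.ofReal_ne_top,
    ProbabilityTheory.lintegral_gaussianPDFReal_eq_one _
      (by have : 0 < a / (1 + a) := by positivity
          simpa using this), mul_one]

/-- If `η` is conditionally `1`-sub-Gaussian and `a`, `b` are known before `η` is revealed, then
the mixture `mix a b η` has conditional expectation at most `1`. For each fixed `s` the mixing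
density at `s` is known as well, so Tonelli reduces the claim to the sub-Gaussian bound. -/
theorem CondSubGaussian.lintegral_mul_mix_le (hF : F ≤ mΩ) (hη : Measurable η)
    (h : CondSubGaussian μ F η 1) {f : Ω → ℝ≥0∞} (hf : Measurable[F] f) {a b : Ω → ℝ}
    (ha : Measurable[F] a) (hb : Measurable[F] b) (ha0 : ∀ ω, 0 ≤ a ω)
    (hab : ∀ ω, a ω = 0 → b ω = 0) :
    ∫⁻ ω, f ω * ENNReal.ofReal (mix (a ω) (b ω) (η ω)) ∂μ ≤ ∫⁻ ω, f ω ∂μ := by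
  have hfm : Measurable f := hf.mono hF le_rfl
  have ham : Measurable a := ha.mono hF le_rfl
  have hbm : Measurable b := hb.mono hF le_rfl
  have hZ : MeasurableSet {ω | a ω = 0} := ham (measurableSet_singleton 0)
  set z : Ω → ℝ≥0∞ := Set.indicator {ω | a ω = 0} f with hz
  have hzm : Measurable z := hfm.indicator hZ
  set k : ℝ → Ω → ℝ≥0∞ := fun s ω => f ω *
    ENNReal.ofReal (ProbabilityTheory.gaussianPDFReal (b ω) (a ω).toNNReal s) with hk
  have hkF : ∀ s, Measurable[F] (k s) := by
    intro s
    refine hf.mul ?_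
    simp only [ProbabilityTheory.gaussianPDFReal]
    fun_prop
  have hkm : Measurable (Function.uncurry k) := by
    refine (hfm.comp measurable_snd).mul ?_
    simp only [ProbabilityTheory.gaussianPDFReal]
    fun_prop
  have hpt : ∀ ω, f ω * ENNReal.ofReal (mix (a ω) (b ω) (η ω)) = z ω +
      ∫⁻ s, k s ω * ENNReal.ofReal (Real.exp (-(s ^ 2) / 2)) *
        ENNReal.ofReal (Real.exp (s * η ω)) := by
    intro ω
    rcases (ha0 ω).eq_or_lt with h0 | h0
    · simp [hz, hk, ← h0, hab ω h0.symm, mix]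
    · rw [hz, Set.indicator_of_notMem (by simpa using h0.ne'), zero_add,
        ← lintegral_gaussian_mul_exp h0, ← lintegral_const_mul]
      · simp only [hk, mul_assoc]
      · have := ProbabilityTheory.measurable_gaussianPDFReal (b ω) (a ω).toNNReal
        fun_prop
  have hpt1 : ∀ ω, z ω + ∫⁻ s, k s ω = f ω := by
    intro ω
    rcases (ha0 ω).eq_or_lt with h0 | h0
    · simp [hz, hk, ← h0]
    · rw [hz, Set.indicator_of_notMem (by simpa using h0.ne'), zero_add, hk,
        lintegral_const_mul, ProbabilityTheory.lintegral_gaussianPDFReal_eq_one, mul_one]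
      · simpa using h0
      · exact (ProbabilityTheory.measurable_gaussianPDFReal _ _).ennreal_ofReal
  calc ∫⁻ ω, f ω * ENNReal.ofReal (mix (a ω) (b ω) (η ω)) ∂μ
      = ∫⁻ ω, z ω ∂μ + ∫⁻ ω, ∫⁻ s, k s ω * ENNReal.ofReal (Real.exp (-(s ^ 2) / 2)) *
          ENNReal.ofReal (Real.exp (s * η ω)) ∂volume ∂μ := by
        simp_rw [hpt]; rw [lintegral_add_left hzm]
    _ = ∫⁻ ω, z ω ∂μ + ∫⁻ s, ∫⁻ ω, k s ω * ENNReal.ofReal (Real.exp (-(s ^ 2) / 2)) *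
          ENNReal.ofReal (Real.exp (s * η ω)) ∂μ := by
        rw [lintegral_lintegral_swap]
        refine Measurable.aemeasurable ?_
        have h1 : Measurable fun p : Ω × ℝ => k p.2 p.1 := hkm.comp measurable_swap
        exact (h1.mul (by fun_prop)).mul (by fun_prop)
    _ ≤ ∫⁻ ω, z ω ∂μ + ∫⁻ s, ∫⁻ ω, k s ω ∂μ := by
        refine add_le_add le_rfl (lintegral_mono fun s => ?_)
        refine (h.lintegral_mul_exp_le hF hη ((hkF s).mul_const _) s).trans (le_of_eq ?_)
        refine lintegral_congr fun ω => ?_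
        rw [mul_assoc, ← ENNReal.ofReal_mul (Real.exp_pos _).le, ← Real.exp_add]
        ring_nf
        simp
    _ = ∫⁻ ω, z ω ∂μ + ∫⁻ ω, ∫⁻ s, k s ω ∂volume ∂μ := by
        rw [lintegral_lintegral_swap]
        exact hkm.aemeasurable
    _ = ∫⁻ ω, f ω ∂μ := by
        rw [← lintegral_add_left hzm]
        simp_rw [hpt1]

/-- Noise with variance proxy `0` vanishes, since `2 ≤ exp η + exp (-η)` with equality only
for `η = 0`. -/
theorem CondSubGaussian.ae_eq_zero (hF : F ≤ mΩ) (h : CondSubGaussian μ F η 0) :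
    ∀ᵐ ω ∂μ, η ω = 0 := by
  have hbound : ∀ s, ∫ ω, Real.exp (s * η ω) ∂μ ≤ 1 := by
    intro s
    rw [← integral_condExp hF]
    have := integral_mono_ae integrable_condExp (integrable_const _) (h s).2
    simpa using this
  have h1 := (h 1).1
  have h2 := (h (-1)).1
  have hnn : ∀ ω, 0 ≤ Real.exp (1 * η ω) + Real.exp (-1 * η ω) - 2 := fun ω => by
    linarith [Real.add_one_le_exp (1 * η ω), Real.add_one_le_exp (-1 * η ω)]
  have hint : Integrable (fun ω => Real.exp (1 * η ω) + Real.exp (-1 * η ω) - 2) μ :=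
    (h1.add h2).sub (integrable_const 2)
  have h0 : ∫ ω, (Real.exp (1 * η ω) + Real.exp (-1 * η ω) - 2) ∂μ = 0 := by
    refine le_antisymm ?_ (integral_nonneg hnn)
    have h12 : Integrable (fun ω => Real.exp (1 * η ω) + Real.exp (-1 * η ω)) μ := h1.add h2
    rw [integral_sub h12 (integrable_const 2), integral_add h1 h2]
    simp only [integral_const, probReal_univ, one_smul]
    linarith [hbound 1, hbound (-1)]
  filter_upwards [(integral_eq_zero_iff_of_nonneg hnn hint).mp h0] with ω hω
  by_contra hne
  have h3 := Real.add_one_lt_exp (x := 1 * η ω) (by simpa using hne)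
  have h4 := Real.add_one_le_exp (-1 * η ω)
  have h5 : Real.exp (1 * η ω) + Real.exp (-1 * η ω) - 2 = 0 := hω
  linarith

end OneStep

/-! ### Ville's inequality on a finite horizon -/

section Ville

variable {Ω : Type*} {mΩ : MeasurableSpace Ω} {μ : Measure Ω}

/-- Ville's maximal inequality. The supermartingale property is stated with test functions that
are known at time `t`. -/
theorem measure_exists_ge_le {F : ℕ → MeasurableSpace Ω} {Q : ℕ → Ω → ℝ≥0∞} {T : ℕ} {c : ℝ≥0∞}
    (hF : ∀ t < T, F t ≤ mΩ) (hQ : ∀ t ≤ T, Measurable (Q t))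
    (hQF : ∀ t < T, ∀ s ≤ t, Measurable[F t] (Q s))
    (hstep : ∀ t < T, ∀ f : Ω → ℝ≥0∞, Measurable[F t] f →
      ∫⁻ ω, f ω * Q (t + 1) ω ∂μ ≤ ∫⁻ ω, f ω * Q t ω ∂μ) :
    c * μ {ω | ∃ t ≤ T, c ≤ Q t ω} ≤ ∫⁻ ω, Q 0 ω ∂μ := by
  classical
  -- the process stopped when it first reaches the level `c`
  let Y : ℕ → Ω → ℝ≥0∞ := fun t => Nat.rec (Q 0) (fun t y ω =>
    if ∃ s ≤ t, c ≤ Q s ω then y ω else Q (t + 1) ω) t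
  have hY : ∀ t ω, Y (t + 1) ω = if ∃ s ≤ t, c ≤ Q s ω then Y t ω else Q (t + 1) ω :=
    fun _ _ => rfl
  have hex : ∀ (𝓖 : MeasurableSpace Ω) (t : ℕ), (∀ s ≤ t, Measurable[𝓖] (Q s)) →
      MeasurableSet[𝓖] {ω | ∃ s ≤ t, c ≤ Q s ω} := by
    intro 𝓖 t h
    have : {ω | ∃ s ≤ t, c ≤ Q s ω} = ⋃ s ∈ Set.Iic t, Q s ⁻¹' Set.Ici c := by
      ext; simp
    rw [this]
    exact MeasurableSet.biUnion (Set.to_countable _) fun s hs => h s hs measurableSet_Ici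
  have hYm : ∀ (𝓖 : MeasurableSpace Ω) (t : ℕ), (∀ s ≤ t, Measurable[𝓖] (Q s)) →
      Measurable[𝓖] (Y t) := by
    intro 𝓖 t
    induction t with
    | zero => exact fun h => h 0 le_rfl
    | succ t ih =>
      intro h
      have h' : ∀ s ≤ t, Measurable[𝓖] (Q s) := fun s hs => h s (hs.trans t.le_succ)
      exact Measurable.ite (hex 𝓖 t h') (ih h') (h _ le_rfl)
  have hYQ : ∀ t ω, (¬ ∃ s < t, c ≤ Q s ω) → Y t ω = Q t ω := by
    intro t ω h
    cases t with
    | zero => rfl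
    | succ t => rw [hY, if_neg]; simpa [Nat.lt_succ_iff] using h
  have hYc : ∀ t ω, (∃ s ≤ t, c ≤ Q s ω) → c ≤ Y t ω := by
    intro t
    induction t with
    | zero => rintro ω ⟨s, hs, h⟩; obtain rfl := Nat.le_zero.mp hs; exact h
    | succ t ih =>
      rintro ω ⟨s, hs, h⟩
      rw [hY]
      split_ifs with hlt
      · exact ih ω hlt
      · rcases hs.eq_or_lt with rfl | hs
        · exact h
        · exact absurd ⟨s, Nat.lt_succ_iff.mp hs, h⟩ hlt
  have hint : ∀ t ≤ T, ∫⁻ ω, Y t ω ∂μ ≤ ∫⁻ ω, Q 0 ω ∂μ := by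
    intro t
    induction t with
    | zero => exact fun _ => le_rfl
    | succ t ih =>
      intro ht
      refine le_trans ?_ (ih (Nat.le_of_succ_le ht))
      have hB := hex (F t) t (hQF t ht)
      have hBm := hF t ht _ hB
      set B := {ω | ∃ s ≤ t, c ≤ Q s ω}
      rw [← lintegral_add_compl _ hBm, ← lintegral_add_compl (Y t) hBm]
      refine add_le_add (le_of_eq ?_) ?_
      · refine setLIntegral_congr_fun hBm fun ω hω => ?_
        exact if_pos hω
      · have h1 : ∫⁻ ω in Bᶜ, Y (t + 1) ω ∂μ = ∫⁻ ω, Bᶜ.indicator 1 ω * Q (t + 1) ω ∂μ := by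
          rw [← lintegral_indicator hBm.compl]
          refine lintegral_congr fun ω => ?_
          by_cases hω : ω ∈ B
          · simp [hω]
          · simp only [Set.mem_compl_iff, hω, not_false_eq_true, Set.indicator_of_mem,
              Pi.one_apply, one_mul]
            exact if_neg hω
        have h2 : ∫⁻ ω in Bᶜ, Y t ω ∂μ = ∫⁻ ω, Bᶜ.indicator 1 ω * Q t ω ∂μ := by
          rw [← lintegral_indicator hBm.compl]
          refine lintegral_congr fun ω => ?_
          by_cases hω : ω ∈ B
          · simp [hω]
          · simp only [Set.mem_compl_iff, hω, not_false_eq_true, Set.indicator_of_mem,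
              Pi.one_apply, one_mul]
            exact hYQ t ω fun ⟨s, hs, h⟩ => hω ⟨s, hs.le, h⟩
        rw [h1, h2]
        exact hstep t ht _ (Measurable.indicator (@measurable_const _ _ _ (F t) 1) hB.compl)
  refine le_trans ?_ (hint T le_rfl)
  refine le_trans ?_ (mul_meas_ge_le_lintegral (hYm mΩ T hQ) c)
  gcongr
  exact fun h => hYc T _ h

end Ville

/-! ### Measurability along a run -/

section Measurability

/-- All entries of a random matrix are measurable. -/
def EntryMeasurable {Ω : Type*} [MeasurableSpace Ω] {d : ℕ} (A : Ω → Mat d) : Prop := ∀ i j, Measurable fun ω => A ω i j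

/-- Measurability of those components of a random state on which the communication pattern and
the noise held back by the agents depend. -/
structure StateMeasurable {Ω : Type*} [MeasurableSpace Ω] {M d : ℕ} (s : Ω → State M d) : Prop where
  cov : ∀ k, EntryMeasurable fun ω => (s ω).cov k
  covLoc : ∀ k, EntryMeasurable fun ω => (s ω).covLoc k
  covSer : EntryMeasurable fun ω => (s ω).covSer
  vecLoc : ∀ k, Measurable fun ω => (s ω).vecLoc k

open Classical in
theorem step_cov {M d : ℕ} (α : ℝ) (s : State M d) (m : Fin M) (x : Vec d) (r : ℝ) (k : Fin M) :
    (step α s m x r).cov k =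
      if Triggers α s m x then
        if k = m then s.covSer + (s.covLoc k + outer x) else s.cov k
      else s.cov k := by
  by_cases h : Triggers α s m x
  · rw [step_of_triggers _ h, if_pos h]
    by_cases hk : k = m
    · simp [hk]
    · simp [hk]
  · rw [step_of_not_triggers _ h, if_neg h, localUpdate]

open Classical in
theorem step_covLoc {M d : ℕ} (α : ℝ) (s : State M d) (m : Fin M) (x : Vec d) (r : ℝ) (k : Fin M) :
    (step α s m x r).covLoc k =
      if k = m then if Triggers α s m x then 0 else s.covLoc k + outer x else s.covLoc k := by
  by_cases h : Triggers α s m x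
  · rw [step_of_triggers _ h, if_pos h]
    by_cases hk : k = m
    · simp [hk]
    · simp [hk]
  · rw [step_of_not_triggers _ h, if_neg h, localUpdate]
    by_cases hk : k = m
    · simp [hk]
    · simp [hk]

open Classical in
theorem step_vecLoc {M d : ℕ} (α : ℝ) (s : State M d) (m : Fin M) (x : Vec d) (r : ℝ) (k : Fin M) :
    (step α s m x r).vecLoc k =
      if k = m then if Triggers α s m x then 0 else s.vecLoc k + r • x else s.vecLoc k := by
  by_cases h : Triggers α s m x
  · rw [step_of_triggers _ h, if_pos h]
    by_cases hk : k = m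
    · simp [hk]
    · simp [hk]
  · rw [step_of_not_triggers _ h, if_neg h, localUpdate]
    by_cases hk : k = m
    · simp [hk]
    · simp [hk]

open Classical in
theorem step_covSer {M d : ℕ} (α : ℝ) (s : State M d) (m : Fin M) (x : Vec d) (r : ℝ) :
    (step α s m x r).covSer =
      if Triggers α s m x then s.covSer + (s.covLoc m + outer x) else s.covSer := by
  by_cases h : Triggers α s m x
  · rw [step_of_triggers _ h, if_pos h]
  · rw [step_of_not_triggers _ h, if_neg h, localUpdate]

variable {Ω : Type*} {mΩ : MeasurableSpace Ω} {M d : ℕ}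

theorem EntryMeasurable.add {A B : Ω → Mat d} (hA : EntryMeasurable A) (hB : EntryMeasurable B) :
    EntryMeasurable fun ω => A ω + B ω := fun i j => (hA i j).add (hB i j)

theorem EntryMeasurable.const_smul {A : Ω → Mat d} (hA : EntryMeasurable A) (c : ℝ) :
    EntryMeasurable fun ω => c • A ω := fun i j => (hA i j).const_mul c

theorem entryMeasurable_const (A : Mat d) : EntryMeasurable fun _ : Ω => A :=
  fun _ _ => measurable_const

theorem EntryMeasurable.ite {p : Ω → Prop} [DecidablePred p] (hp : MeasurableSet {ω | p ω})
    {A B : Ω → Mat d} (hA : EntryMeasurable A) (hB : EntryMeasurable B) :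
    EntryMeasurable fun ω => if p ω then A ω else B ω := by
  intro i j
  have h : ∀ ω, (if p ω then A ω else B ω) i j = if p ω then A ω i j else B ω i j := fun ω => by
    split_ifs <;> rfl
  simp only [h]
  exact Measurable.ite hp (hA i j) (hB i j)

theorem EntryMeasurable.det {A : Ω → Mat d} (hA : EntryMeasurable A) :
    Measurable fun ω => (A ω).det := by
  simp only [det_apply']
  exact Finset.measurable_sum _ fun σ _ =>
    (Finset.measurable_prod _ fun i _ => hA _ _).const_mul _

theorem EntryMeasurable.inv {A : Ω → Mat d} (hA : EntryMeasurable A) :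
    EntryMeasurable fun ω => (A ω)⁻¹ := by
  intro i j
  simp only [inv_def, Ring.inverse_eq_inv', Matrix.smul_apply, smul_eq_mul, adjugate_apply]
  refine hA.det.inv.mul (EntryMeasurable.det fun k l => ?_)
  by_cases hk : k = j
  · subst hk; simp
  · simpa [updateRow_ne hk] using hA k l

theorem EntryMeasurable.bilin {A : Ω → Mat d} (hA : EntryMeasurable A) {u v : Ω → Fin d → ℝ}
    (hu : Measurable u) (hv : Measurable v) : Measurable fun ω => u ω ⬝ᵥ A ω *ᵥ v ω := by
  simp only [dotProduct, mulVec]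
  refine Finset.measurable_sum _ fun i _ => ((measurable_pi_apply i).comp hu).mul ?_
  exact Finset.measurable_sum _ fun j _ => (hA i j).mul ((measurable_pi_apply j).comp hv)

theorem EntryMeasurable.mulVec_const {A : Ω → Mat d} (hA : EntryMeasurable A) (v : Fin d → ℝ) :
    Measurable fun ω => A ω *ᵥ v := by
  refine measurable_pi_lambda _ fun i => ?_
  simp only [mulVec, dotProduct]
  exact Finset.measurable_sum _ fun j _ => (hA i j).mul_const _

theorem measurable_ofLp {x : Ω → Vec d} (hx : Measurable x) : Measurable fun ω => (x ω).ofLp :=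
  (PiLp.continuous_ofLp 2 _).measurable.comp hx

theorem entryMeasurable_outer {x : Ω → Vec d} (hx : Measurable x) :
    EntryMeasurable fun ω => outer (x ω) := by
  intro i j
  have := measurable_ofLp hx
  exact ((measurable_pi_apply i).comp this).mul ((measurable_pi_apply j).comp this)

theorem measurable_apply_index {E : Type*} [MeasurableSpace E] {m : Ω → Fin M}
    (hm : Measurable m) {f : Fin M → Ω → E} (hf : ∀ k, Measurable (f k)) :
    Measurable fun ω => f (m ω) ω := by
  intro B hB
  have : (fun ω => f (m ω) ω) ⁻¹' B = ⋃ k, m ⁻¹' {k} ∩ f k ⁻¹' B := by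
    ext ω; simp
  rw [this]
  exact MeasurableSet.iUnion fun k => (hm (measurableSet_singleton k)).inter (hf k hB)

variable {α lam : ℝ} {s : Ω → State M d} {m : Ω → Fin M} {x : Ω → Vec d} {r : Ω → ℝ}

theorem StateMeasurable.measurableSet_triggers (hs : StateMeasurable s) (hm : Measurable m)
    (hx : Measurable x) : MeasurableSet {ω | Triggers α (s ω) (m ω) (x ω)} := by
  refine measurableSet_lt ?_ ?_
  · exact (measurable_apply_index hm fun k => (hs.cov k).det).const_mul _
  · exact measurable_apply_index hm (f := fun k ω => ((s ω).cov k + ((s ω).covLoc k +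
      outer (x ω))).det) fun k =>
        ((hs.cov k).add ((hs.covLoc k).add (entryMeasurable_outer hx))).det

theorem StateMeasurable.step (hs : StateMeasurable s) (hm : Measurable m)
    (hx : Measurable x) (hr : Measurable r) :
    StateMeasurable fun ω => step α (s ω) (m ω) (x ω) (r ω) := by
  classical
  have htrig := hs.measurableSet_triggers (α := α) hm hx
  have hk : ∀ k, MeasurableSet {ω | k = m ω} := fun k =>
    measurableSet_eq_fun measurable_const hm
  have hloc := fun k => (hs.covLoc k).add (entryMeasurable_outer hx)
  have hveck := fun k => (hs.vecLoc k).add (hr.smul hx)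
  have hser := fun k => hs.covSer.add (hloc k)
  refine ⟨fun k => ?_, fun k => ?_, ?_, fun k => ?_⟩
  · simp only [step_cov]
    exact .ite htrig (.ite (hk k) (hser k) (hs.cov k)) (hs.cov k)
  · simp only [step_covLoc]
    exact .ite (hk k) (.ite htrig (entryMeasurable_const 0) (hloc k)) (hs.covLoc k)
  · simp only [step_covSer]
    exact .ite htrig (fun i j => measurable_apply_index hm
      (f := fun k ω => ((s ω).covSer + ((s ω).covLoc k + outer (x ω))) i j)
      fun k => hser k i j) hs.covSer
  · simp only [step_vecLoc]
    exact .ite (hk k) (.ite htrig measurable_const (hveck k)) (hs.vecLoc k)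

variable {m : ℕ → Ω → Fin M} {x : ℕ → Ω → Vec d} {r : ℕ → Ω → ℝ} {t : ℕ}

theorem stateMeasurable_state (hm : ∀ i < t, Measurable (m i)) (hx : ∀ i < t, Measurable (x i))
    (hr : ∀ i < t, Measurable (r i)) :
    StateMeasurable fun ω => state α lam (fun i => m i ω) (fun i => x i ω) (fun i => r i ω) t := by
  induction t with
  | zero => exact ⟨fun k => entryMeasurable_const _, fun k => entryMeasurable_const _,
      entryMeasurable_const _, fun k => measurable_const⟩
  | succ t ih =>
    have hlt : ∀ i < t, i < t + 1 := fun i hi => hi.trans t.lt_succ_self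
    exact (ih (fun i hi => hm i (hlt i hi)) (fun i hi => hx i (hlt i hi))
      (fun i hi => hr i (hlt i hi))).step (hm t t.lt_succ_self) (hx t t.lt_succ_self)
      (hr t t.lt_succ_self)

theorem measurable_trigCount (hm : ∀ i < t, Measurable (m i)) (hx : ∀ i < t, Measurable (x i))
    (hr : ∀ i < t, Measurable (r i)) :
    Measurable fun ω => trigCount α lam (fun i => m i ω) (fun i => x i ω) (fun i => r i ω) t := by
  classical
  refine Finset.measurable_sum _ fun i hi => ?_
  have hi := Finset.mem_range.mp hi
  refine Measurable.ite ?_ measurable_const measurable_const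
  exact (stateMeasurable_state (fun j hj => hm j (hj.trans hi)) (fun j hj => hx j (hj.trans hi))
    (fun j hj => hr j (hj.trans hi))).measurableSet_triggers (hm i hi) (hx i hi)

theorem entryMeasurable_totalCov (hx : ∀ i < t, Measurable (x i)) :
    EntryMeasurable fun ω => totalCov lam (fun i => x i ω) t := by
  induction t with
  | zero => simpa [totalCov] using entryMeasurable_const _
  | succ t ih =>
    simp only [totalCov_succ]
    exact (ih fun i hi => hx i (hi.trans t.lt_succ_self)).add
      (entryMeasurable_outer (hx t t.lt_succ_self))

theorem measurable_noiseSum (θ : Vec d) (hx : ∀ i < t, Measurable (x i))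
    (hr : ∀ i < t, Measurable (r i)) :
    Measurable fun ω => noiseSum θ (fun i => x i ω) (fun i => r i ω) t := by
  refine Finset.measurable_sum _ fun i hi => ?_
  have hi := Finset.mem_range.mp hi
  exact ((hr i hi).sub ((hx i hi).inner measurable_const)).smul (measurable_ofLp (hx i hi))

theorem StateMeasurable.locNoise (hs : StateMeasurable s) (θ : Vec d) (k : Fin M) :
    Measurable fun ω => locNoise θ (s ω) k :=
  (measurable_ofLp (hs.vecLoc k)).sub ((hs.covLoc k).mulVec_const _)

theorem StateMeasurable.locCov (hs : StateMeasurable s) (k : Fin M) :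
    EntryMeasurable fun ω => locCov α (s ω) k := ((hs.cov k).const_smul α).add (hs.covLoc k)

end Measurability

/-! ### The noise supermartingale -/

section Wealth

/-- The Gaussian mixture of `exp (⟨u, v⟩ - ‖u‖²_{A - P} / 2)` over `u` distributed as
`N(0, P⁻¹)`. -/
noncomputable def wealth {d : ℕ} (A P : Mat d) (v : Fin d → ℝ) : ℝ :=
  √(P.det / A.det) * Real.exp ((v ⬝ᵥ A⁻¹ *ᵥ v) / 2)

variable {M d : ℕ} {α lam R : ℝ}

theorem wealth_nonneg (A P : Mat d) (v : Fin d → ℝ) : 0 ≤ wealth A P v := by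
  unfold wealth; positivity

theorem wealth_self {P : Mat d} (hP : P.PosDef) : wealth P P 0 = 1 := by
  simp [wealth, div_self hP.det_pos.ne']

theorem wealth_add_outer {A : Mat d} (hA : A.PosDef) (P : Mat d) (v : Fin d → ℝ)
    (x : Vec d) (e : ℝ) : wealth (A + outer x) P (v + e • x.ofLp) =
      wealth A P v * mix (x.ofLp ⬝ᵥ A⁻¹ *ᵥ x.ofLp) (x.ofLp ⬝ᵥ A⁻¹ *ᵥ v) e := by
  have ha := quad_inv_nonneg hA x.ofLp
  have hvx := bilin_comm hA.inv.isHermitian v x.ofLp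
  rw [wealth, wealth, mix, outer, det_add_outer hA, bilin_inv_add_outer hA]
  simp only [mulVec_add, mulVec_smul, dotProduct_add, add_dotProduct, smul_dotProduct,
    dotProduct_smul, smul_eq_mul, hvx]
  set a := x.ofLp ⬝ᵥ A⁻¹ *ᵥ x.ofLp
  set b := x.ofLp ⬝ᵥ A⁻¹ *ᵥ v
  set c := v ⬝ᵥ A⁻¹ *ᵥ v
  have h1 : 0 < 1 + a := by linarith
  rw [← div_div, Real.sqrt_div' _ h1.le]
  have key : Real.exp ((c + e * b + e * (b + e * a) - (b + e * a) * (b + e * a) / (1 + a)) / 2) =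
      Real.exp (c / 2) * Real.exp ((2 * e * b + e ^ 2 * a - b ^ 2) / (2 * (1 + a))) := by
    rw [← Real.exp_add]
    congr 1
    field_simp
    ring
  convert congrArg (fun z => √(P.det / A.det) / √(1 + a) * z) key using 1
  ring_nf

theorem quad_le_of_wealth_le {A P : Mat d} (hA : A.PosDef) (hP : P.PosDef) {v : Fin d → ℝ}
    {c : ℝ} (h : wealth A P v ≤ c) :
    v ⬝ᵥ A⁻¹ *ᵥ v ≤ 2 * Real.log c + (Real.log A.det - Real.log P.det) := by
  have hpos : 0 < P.det / A.det := div_pos hP.det_pos hA.det_pos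
  have hs : 0 < √(P.det / A.det) := Real.sqrt_pos.mpr hpos
  have h1 := Real.log_le_log (mul_pos hs (Real.exp_pos _)) h
  rw [Real.log_mul hs.ne' (Real.exp_pos _).ne', Real.log_exp, Real.log_sqrt hpos.le,
    Real.log_div hP.det_pos.ne' hA.det_pos.ne'] at h1
  linarith

/-- The wealth of the noise of the whole run. -/
noncomputable def allWealth (lam R : ℝ) (θ : Vec d) (x : ℕ → Vec d) (r : ℕ → ℝ) (t : ℕ) : ℝ :=
  wealth (totalCov lam x t) (lam • (1 : Mat d)) (R⁻¹ • noiseSum θ x r t)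

/-- The wealth of the noise that agent `k` holds back. It is normalized by `α` times the matrix
the agent has downloaded, so that the determinant of the normalization stays bounded. -/
noncomputable def locWealth (α R : ℝ) (θ : Vec d) (s : State M d) (k : Fin M) : ℝ :=
  wealth (locCov α s k) (α • s.cov k) (R⁻¹ • locNoise θ s k)

/-- The total capital: a share `p` is staked on the whole run, a share `q` on each of the batches
of data held back by an agent. At most `M + N` batches are ever started, where `N` bounds the
number of communications; a new batch is paid for from the reserve. -/
noncomputable def capital (α lam R p q N : ℝ) (θ : Vec d) (m : ℕ → Fin M) (x : ℕ → Vec d)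
    (r : ℕ → ℝ) (t : ℕ) : ℝ :=
  p * allWealth lam R θ x r t +
    q * (∑ k, locWealth α R θ (state α lam m x r t) k + (N - trigCount α lam m x r t))

variable {p q N : ℝ} {θ : Vec d} {m : ℕ → Fin M} {x : ℕ → Vec d} {r : ℕ → ℝ}

theorem allWealth_succ (hlam : 0 < lam) (t : ℕ) : allWealth lam R θ x r (t + 1) =
    allWealth lam R θ x r t *
      mix ((x t).ofLp ⬝ᵥ (totalCov lam x t)⁻¹ *ᵥ (x t).ofLp)
        ((x t).ofLp ⬝ᵥ (totalCov lam x t)⁻¹ *ᵥ (R⁻¹ • noiseSum θ x r t))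
        ((r t - inner ℝ (x t) θ) / R) := by
  rw [allWealth, totalCov_succ, noiseSum, Finset.sum_range_succ, smul_add, smul_smul,
    ← noiseSum, inv_mul_eq_div, wealth_add_outer (totalCov_posDef hlam t), allWealth]

theorem locWealth_localUpdate (hα : 0 < α) (hlam : 0 < lam) {s : State M d}
    (hs : Valid α lam s) (k : Fin M) (y : Vec d) (ρ : ℝ) :
    locWealth α R θ (localUpdate s k y ρ) k = locWealth α R θ s k *
      mix (y.ofLp ⬝ᵥ (locCov α s k)⁻¹ *ᵥ y.ofLp)
        (y.ofLp ⬝ᵥ (locCov α s k)⁻¹ *ᵥ (R⁻¹ • locNoise θ s k)) ((ρ - inner ℝ y θ) / R) := by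
  have h1 : locCov α (localUpdate s k y ρ) k = locCov α s k + outer y := by
    simp [locCov, localUpdate, add_assoc]
  have h2 : R⁻¹ • locNoise θ (localUpdate s k y ρ) k =
      R⁻¹ • locNoise θ s k + ((ρ - inner ℝ y θ) / R) • y.ofLp := by
    rw [div_eq_inv_mul, ← smul_smul, ← smul_add]
    congr 1
    simp only [locNoise, localUpdate, Function.update_self, add_mulVec, outer_mulVec_ofLp,
      WithLp.ofLp_add, WithLp.ofLp_smul, sub_smul]
    abel
  rw [locWealth, h1, h2, wealth_add_outer (hs.locCov_posDef hα hlam k), locWealth]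
  rfl

/-- The one-step change of the capital. A communication closes one batch, whose wealth is dropped,
and starts another one with wealth `1`. -/
theorem capital_succ_le (hα : 0 < α) (hlam : 0 < lam) (hq : 0 ≤ q) (t : ℕ) :
    capital α lam R p q N θ m x r (t + 1) ≤
      q * (∑ k ∈ Finset.univ.erase (m t), locWealth α R θ (state α lam m x r t) k +
        (N - trigCount α lam m x r t)) +
      p * allWealth lam R θ x r t * mix ((x t).ofLp ⬝ᵥ (totalCov lam x t)⁻¹ *ᵥ (x t).ofLp)
        ((x t).ofLp ⬝ᵥ (totalCov lam x t)⁻¹ *ᵥ (R⁻¹ • noiseSum θ x r t))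
        ((r t - inner ℝ (x t) θ) / R) +
      q * locWealth α R θ (state α lam m x r t) (m t) *
        mix ((x t).ofLp ⬝ᵥ (locCov α (state α lam m x r t) (m t))⁻¹ *ᵥ (x t).ofLp)
          ((x t).ofLp ⬝ᵥ (locCov α (state α lam m x r t) (m t))⁻¹ *ᵥ
            (R⁻¹ • locNoise θ (state α lam m x r t) (m t)))
          ((r t - inner ℝ (x t) θ) / R) := by
  have hs := valid_state (α := α) (lam := lam) (m := m) (x := x) (r := r) hα hlam t
  rw [capital, allWealth_succ hlam, trigCount, Finset.sum_range_succ, ← trigCount, state,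
    ← Finset.add_sum_erase _ _ (Finset.mem_univ (m t))]
  set s := state α lam m x r t
  by_cases h : Triggers α s (m t) (x t)
  · rw [if_pos h]
    have h1 : ∀ k ∈ Finset.univ.erase (m t),
        locWealth α R θ (step α s (m t) (x t) (r t)) k = locWealth α R θ s k := by
      intro k hk
      have hk := Finset.ne_of_mem_erase hk
      rw [step_of_triggers _ h]
      simp [locWealth, locCov, locNoise, hk]
    have h2 : locWealth α R θ (step α s (m t) (x t) (r t)) (m t) = 1 := by
      have hpd : (α • (s.covSer + (s.covLoc (m t) + outer (x t)))).PosDef :=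
        ((hs.covSer_posDef hlam).add_gram (hs.loc_add_gram _ _)).smul hα
      rw [step_of_triggers _ h]
      simpa [locWealth, locCov, locNoise] using wealth_self hpd
    rw [Finset.sum_congr rfl h1, h2]
    have h3 := mul_nonneg (mul_nonneg hq (wealth_nonneg (locCov α s (m t)) (α • s.cov (m t))
      (R⁻¹ • locNoise θ s (m t)))) (mix_nonneg ((x t).ofLp ⬝ᵥ (locCov α s (m t))⁻¹ *ᵥ (x t).ofLp)
          ((x t).ofLp ⬝ᵥ (locCov α s (m t))⁻¹ *ᵥ (R⁻¹ • locNoise θ s (m t)))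
          ((r t - inner ℝ (x t) θ) / R))
    rw [← locWealth] at h3
    linarith
  · rw [if_neg h, step_of_not_triggers _ h]
    have h1 : ∀ k ∈ Finset.univ.erase (m t),
        locWealth α R θ (localUpdate s (m t) (x t) (r t)) k = locWealth α R θ s k := by
      intro k hk
      have hk := Finset.ne_of_mem_erase hk
      simp [locWealth, locCov, locNoise, localUpdate, hk]
    rw [Finset.sum_congr rfl h1, locWealth_localUpdate hα hlam hs]
    linarith

theorem capital_zero (hα : 0 < α) (hlam : 0 < lam) :
    capital α lam R p q N θ m x r 0 = p + q * (M + N) := by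
  have h1 := wealth_self (posDef_smul_one (d := d) hlam)
  have h2 := wealth_self ((posDef_smul_one (d := d) hlam).smul hα)
  simp [capital, allWealth, locWealth, totalCov, noiseSum, trigCount, state, init, locCov,
    locNoise, h1, h2]

end Wealth

/-! ### The good event -/

section Event

variable {Ω : Type*} {mΩ : MeasurableSpace Ω} {M d : ℕ} {α lam R : ℝ}
  {m : ℕ → Ω → Fin M} {x : ℕ → Ω → Vec d} {r : ℕ → Ω → ℝ}

theorem EntryMeasurable.wealth {A P : Ω → Mat d} {v : Ω → Fin d → ℝ} (hA : EntryMeasurable A)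
    (hP : EntryMeasurable P) (hv : Measurable v) :
    Measurable fun ω => wealth (A ω) (P ω) (v ω) :=
  ((hP.det.div hA.det).sqrt).mul (((hA.inv.bilin hv hv).div_const 2).exp)

theorem StateMeasurable.locWealth {s : Ω → State M d} (hs : StateMeasurable s) (θ : Vec d)
    (k : Fin M) : Measurable fun ω => locWealth α R θ (s ω) k :=
  (hs.locCov k).wealth ((hs.cov k).const_smul α) ((hs.locNoise θ k).const_smul R⁻¹)

theorem measurable_allWealth {t : ℕ} (θ : Vec d) (hx : ∀ i < t, Measurable (x i))
    (hr : ∀ i < t, Measurable (r i)) :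
    Measurable fun ω => allWealth lam R θ (fun i => x i ω) (fun i => r i ω) t :=
  (entryMeasurable_totalCov hx).wealth (entryMeasurable_const _)
    ((measurable_noiseSum θ hx hr).const_smul R⁻¹)

theorem measurable_capital {t : ℕ} {p q N : ℝ} (θ : Vec d) (hm : ∀ i < t, Measurable (m i))
    (hx : ∀ i < t, Measurable (x i)) (hr : ∀ i < t, Measurable (r i)) :
    Measurable fun ω => capital α lam R p q N θ (fun i => m i ω) (fun i => x i ω)
      (fun i => r i ω) t :=
  ((measurable_allWealth θ hx hr).const_mul p).add
    (((Finset.measurable_sum _ fun k _ => (stateMeasurable_state hm hx hr).locWealth θ k).add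
      ((measurable_trigCount hm hx hr).const_sub N)).const_mul q)

theorem measurable_history_action {t i : ℕ} (hi : i ≤ t) : Measurable[history m x r t] (x i) := by
  rw [measurable_iff_comap_le]
  refine le_sup_of_le_left (le_iSup₂_of_le i (Finset.mem_range.mpr (Nat.lt_succ_of_le hi)) ?_)
  exact le_sup_left

theorem measurable_history_agent {t i : ℕ} (hi : i ≤ t) : Measurable[history m x r t] (m i) := by
  rw [measurable_iff_comap_le]
  refine le_sup_of_le_left (le_iSup₂_of_le i (Finset.mem_range.mpr (Nat.lt_succ_of_le hi)) ?_)
  exact le_sup_right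

theorem measurable_history_reward {t i : ℕ} (hi : i < t) : Measurable[history m x r t] (r i) := by
  rw [measurable_iff_comap_le]
  exact le_sup_of_le_right (le_iSup₂_of_le i (Finset.mem_range.mpr hi) le_rfl)

theorem history_le {t : ℕ} (hm : ∀ i ≤ t, Measurable (m i)) (hx : ∀ i ≤ t, Measurable (x i))
    (hr : ∀ i < t, Measurable (r i)) : history m x r t ≤ mΩ := by
  refine sup_le (iSup₂_le fun i hi => sup_le ?_ ?_) (iSup₂_le fun i hi => ?_)
  · exact (hx i (Nat.lt_succ_iff.mp (Finset.mem_range.mp hi))).comap_le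
  · exact (hm i (Nat.lt_succ_iff.mp (Finset.mem_range.mp hi))).comap_le
  · exact (hr i (Finset.mem_range.mp hi)).comap_le

variable {μ : Measure Ω} [IsProbabilityMeasure μ] {η : ℕ → Ω → ℝ} {T : ℕ} {θ : Vec d}

/-- With probability at least `1 - δ` the capital stays below `1 / δ`. -/
theorem measure_capital_ge_le {p q N δ : ℝ} (hα : 0 < α) (hlam : 0 < lam) (hR : 0 < R)
    (hδ : 0 < δ) (hp : 0 ≤ p) (hq : 0 ≤ q) (hpq : p + q * (M + N) ≤ 1)
    (hm : ∀ t < T, Measurable (m t)) (hx : ∀ t < T, Measurable (x t))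
    (hη : ∀ t < T, Measurable (η t)) (hr : ∀ t < T, ∀ ω, r t ω = inner ℝ (x t ω) θ + η t ω)
    (hnoise : ∀ t < T, CondSubGaussian μ (history m x r t) (η t) R)
    (hN : ∀ t ≤ T, ∀ ω, trigCount α lam (fun i => m i ω) (fun i => x i ω) (fun i => r i ω) t ≤ N) :
    μ {ω | ∃ t ≤ T, 1 / δ ≤ capital α lam R p q N θ (fun i => m i ω) (fun i => x i ω)
      (fun i => r i ω) t} ≤ ENNReal.ofReal δ := by
  have hrm : ∀ t < T, Measurable (r t) := fun t ht => by
    rw [funext (hr t ht)]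
    exact ((hx t ht).inner measurable_const).add (hη t ht)
  set Q : ℕ → Ω → ℝ≥0∞ := fun t ω => ENNReal.ofReal (capital α lam R p q N θ (fun i => m i ω)
    (fun i => x i ω) (fun i => r i ω) t) with hQ
  have hF : ∀ t < T, history m x r t ≤ mΩ := fun t ht =>
    history_le (fun i hi => hm i (hi.trans_lt ht)) (fun i hi => hx i (hi.trans_lt ht))
      (fun i hi => hrm i (hi.trans ht))
  have hville : ENNReal.ofReal (1 / δ) * μ {ω | ∃ t ≤ T, ENNReal.ofReal (1 / δ) ≤ Q t ω} ≤
      ∫⁻ ω, Q 0 ω ∂μ := by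
    refine measure_exists_ge_le hF (fun t ht => ?_) (fun t ht s hs => ?_) fun t ht f hf => ?_
    · exact (measurable_capital θ (fun i hi => hm i (hi.trans_le ht))
        (fun i hi => hx i (hi.trans_le ht)) (fun i hi => hrm i (hi.trans_le ht))).ennreal_ofReal
    · exact (measurable_capital θ (fun i hi => measurable_history_agent (hi.le.trans hs))
        (fun i hi => measurable_history_action (hi.le.trans hs))
        (fun i hi => measurable_history_reward (hi.trans_le hs))).ennreal_ofReal
    · have hmF : ∀ i ≤ t, Measurable[history m x r t] (m i) := fun i hi =>
        measurable_history_agent hi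
      have hxF : ∀ i ≤ t, Measurable[history m x r t] (x i) := fun i hi =>
        measurable_history_action hi
      have hrF : ∀ i < t, Measurable[history m x r t] (r i) := fun i hi =>
        measurable_history_reward hi
      have hst := stateMeasurable_state (α := α) (lam := lam) (fun i hi => hmF i hi.le)
        (fun i hi => hxF i hi.le) hrF
      have hxt := measurable_ofLp (hxF t le_rfl)
      have hV : @EntryMeasurable Ω (history m x r t) d _ :=
        entryMeasurable_totalCov (lam := lam) (t := t) (fun i hi => hxF i hi.le)
      have hS := (measurable_noiseSum θ (fun i hi => hxF i (le_of_lt hi)) hrF).const_smul R⁻¹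
      -- the parameters of the two mixtures, and the parts of the capital they multiply
      set s : Ω → State M d := fun ω => state α lam (fun i => m i ω) (fun i => x i ω)
        (fun i => r i ω) t with hs
      let ag : Ω → ℝ := fun ω => (x t ω).ofLp ⬝ᵥ (totalCov lam (fun i => x i ω) t)⁻¹ *ᵥ (x t ω).ofLp
      let bg : Ω → ℝ := fun ω => (x t ω).ofLp ⬝ᵥ (totalCov lam (fun i => x i ω) t)⁻¹ *ᵥ
        (R⁻¹ • noiseSum θ (fun i => x i ω) (fun i => r i ω) t)
      let al : Ω → ℝ := fun ω => (x t ω).ofLp ⬝ᵥ (locCov α (s ω) (m t ω))⁻¹ *ᵥ (x t ω).ofLp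
      let bl : Ω → ℝ := fun ω => (x t ω).ofLp ⬝ᵥ (locCov α (s ω) (m t ω))⁻¹ *ᵥ
        (R⁻¹ • locNoise θ (s ω) (m t ω))
      let U : Ω → ℝ := fun ω => q * (∑ k ∈ Finset.univ.erase (m t ω), locWealth α R θ (s ω) k +
        (N - trigCount α lam (fun i => m i ω) (fun i => x i ω) (fun i => r i ω) t))
      let V : Ω → ℝ := fun ω => p * allWealth lam R θ (fun i => x i ω) (fun i => r i ω) t
      let W : Ω → ℝ := fun ω => q * locWealth α R θ (s ω) (m t ω)
      have hag : Measurable[history m x r t] ag := hV.inv.bilin hxt hxt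
      have hbg : Measurable[history m x r t] bg := hV.inv.bilin hxt hS
      have hal : Measurable[history m x r t] al := measurable_apply_index (hmF t le_rfl)
        (f := fun k ω => (x t ω).ofLp ⬝ᵥ (locCov α (s ω) k)⁻¹ *ᵥ (x t ω).ofLp)
        fun k => (hst.locCov k).inv.bilin hxt hxt
      have hbl : Measurable[history m x r t] bl := measurable_apply_index (hmF t le_rfl)
        (f := fun k ω => (x t ω).ofLp ⬝ᵥ (locCov α (s ω) k)⁻¹ *ᵥ (R⁻¹ • locNoise θ (s ω) k))
        fun k => (hst.locCov k).inv.bilin hxt ((hst.locNoise θ k).const_smul R⁻¹)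
      have hU : Measurable[history m x r t] U := measurable_apply_index (hmF t le_rfl)
        (f := fun k' ω => q * (∑ k ∈ Finset.univ.erase k', locWealth α R θ (s ω) k +
          (N - trigCount α lam (fun i => m i ω) (fun i => x i ω) (fun i => r i ω) t)))
        fun k' => ((Finset.measurable_sum _ fun k _ => hst.locWealth θ k).add
          ((measurable_trigCount (fun i hi => hmF i (le_of_lt hi))
            (fun i hi => hxF i (le_of_lt hi)) hrF).const_sub N)).const_mul q
      have hVm : Measurable[history m x r t] V :=
        (measurable_allWealth θ (fun i hi => hxF i (le_of_lt hi)) hrF).const_mul p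
      have hW : Measurable[history m x r t] W := measurable_apply_index (hmF t le_rfl)
        (f := fun k ω => q * locWealth α R θ (s ω) k) fun k => (hst.locWealth θ k).const_mul q
      have hU0 : ∀ ω, 0 ≤ U ω := fun ω => mul_nonneg hq (add_nonneg
        (Finset.sum_nonneg fun k _ => wealth_nonneg _ _ _) (sub_nonneg.mpr (hN t ht.le ω)))
      have hV0 : ∀ ω, 0 ≤ V ω := fun ω => mul_nonneg hp (wealth_nonneg _ _ _)
      have hW0 : ∀ ω, 0 ≤ W ω := fun ω => mul_nonneg hq (wealth_nonneg _ _ _)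
      have hpdl : ∀ ω, (locCov α (s ω) (m t ω)).PosDef := fun ω =>
        (valid_state hα hlam t).locCov_posDef hα hlam _
      have hzero : ∀ {A : Mat d} (_ : A.PosDef) (y v : Fin d → ℝ), y ⬝ᵥ A⁻¹ *ᵥ y = 0 →
          y ⬝ᵥ A⁻¹ *ᵥ v = 0 := by
        intro A hA y v h0
        have := bilin_sq_le hA.inv.posSemidef y v
        rw [h0, zero_mul] at this
        exact pow_eq_zero_iff two_ne_zero |>.mp (le_antisymm this (sq_nonneg _))
      have hsub := (hnoise t ht).div_const hR
      have hηR : Measurable fun ω => η t ω / R := (hη t ht).div_const R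
      have hstepg := hsub.lintegral_mul_mix_le (hF t ht) hηR
        (hf.mul hVm.ennreal_ofReal) hag hbg
        (fun ω => quad_inv_nonneg (totalCov_posDef hlam t) _)
        (fun ω => hzero (totalCov_posDef hlam t) _ _)
      have hstepl := hsub.lintegral_mul_mix_le (hF t ht) hηR
        (hf.mul hW.ennreal_ofReal) hal hbl
        (fun ω => quad_inv_nonneg (hpdl ω) _) (fun ω => hzero (hpdl ω) _ _)
      have hle : ∀ ω, f ω * Q (t + 1) ω ≤ f ω * ENNReal.ofReal (U ω) +
          f ω * ENNReal.ofReal (V ω) * ENNReal.ofReal (mix (ag ω) (bg ω) (η t ω / R)) +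
          f ω * ENNReal.ofReal (W ω) * ENNReal.ofReal (mix (al ω) (bl ω) (η t ω / R)) := by
        intro ω
        have h1 := capital_succ_le (R := R) (p := p) (N := N) (θ := θ) (m := fun i => m i ω)
          (x := fun i => x i ω) (r := fun i => r i ω) hα hlam hq t
        have h2 : r t ω - inner ℝ (x t ω) θ = η t ω := by rw [hr t ht ω]; ring
        simp only [h2] at h1
        rw [mul_assoc, mul_assoc, ← mul_add, ← mul_add, ← ENNReal.ofReal_mul (hV0 ω),
          ← ENNReal.ofReal_mul (hW0 ω), ← ENNReal.ofReal_add (hU0 ω)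
            (mul_nonneg (hV0 ω) (mix_nonneg _ _ _)), ← ENNReal.ofReal_add
            (add_nonneg (hU0 ω) (mul_nonneg (hV0 ω) (mix_nonneg _ _ _)))
            (mul_nonneg (hW0 ω) (mix_nonneg _ _ _))]
        exact mul_le_mul_right (ENNReal.ofReal_le_ofReal h1) _
      have heq : ∀ ω, f ω * Q t ω = f ω * ENNReal.ofReal (U ω) + f ω * ENNReal.ofReal (V ω) +
          f ω * ENNReal.ofReal (W ω) := by
        intro ω
        rw [← mul_add, ← mul_add, ← ENNReal.ofReal_add (hU0 ω) (hV0 ω),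
          ← ENNReal.ofReal_add (add_nonneg (hU0 ω) (hV0 ω)) (hW0 ω)]
        have h := Finset.add_sum_erase Finset.univ (fun k => locWealth α R θ (s ω) k)
          (Finset.mem_univ (m t ω))
        refine congrArg (f ω * ENNReal.ofReal ·) ?_
        simp only [U, V, W, capital]
        linear_combination -q * h
      have hfm := hf.mono (hF t ht) le_rfl
      have hUm := hU.mono (hF t ht) le_rfl
      have hVm' := hVm.mono (hF t ht) le_rfl
      have hWm := hW.mono (hF t ht) le_rfl
      have hmixm : Measurable fun ω => mix (ag ω) (bg ω) (η t ω / R) := by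
        have h1 := hag.mono (hF t ht) le_rfl
        have h2 := hbg.mono (hF t ht) le_rfl
        unfold mix
        fun_prop
      calc ∫⁻ ω, f ω * Q (t + 1) ω ∂μ ≤ _ := lintegral_mono hle
        _ = ∫⁻ ω, f ω * ENNReal.ofReal (U ω) ∂μ +
            ∫⁻ ω, f ω * ENNReal.ofReal (V ω) *
              ENNReal.ofReal (mix (ag ω) (bg ω) (η t ω / R)) ∂μ +
            ∫⁻ ω, f ω * ENNReal.ofReal (W ω) *
              ENNReal.ofReal (mix (al ω) (bl ω) (η t ω / R)) ∂μ := by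
          rw [lintegral_add_left, lintegral_add_left]
          · exact hfm.mul hUm.ennreal_ofReal
          · exact (hfm.mul hUm.ennreal_ofReal).add
              ((hfm.mul hVm'.ennreal_ofReal).mul hmixm.ennreal_ofReal)
        _ ≤ ∫⁻ ω, f ω * ENNReal.ofReal (U ω) ∂μ + ∫⁻ ω, f ω * ENNReal.ofReal (V ω) ∂μ +
            ∫⁻ ω, f ω * ENNReal.ofReal (W ω) ∂μ :=
          add_le_add (add_le_add le_rfl hstepg) hstepl
        _ = ∫⁻ ω, f ω * Q t ω ∂μ := by
          simp_rw [heq]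
          rw [lintegral_add_left, lintegral_add_left]
          · exact hfm.mul hUm.ennreal_ofReal
          · exact (hfm.mul hUm.ennreal_ofReal).add (hfm.mul hVm'.ennreal_ofReal)
  have hQ0 : ∫⁻ ω, Q 0 ω ∂μ ≤ 1 := by
    simp only [hQ, capital_zero hα hlam, lintegral_const, measure_univ, mul_one]
    exact ENNReal.ofReal_le_one.mpr hpq
  have hsubset : {ω | ∃ t ≤ T, 1 / δ ≤ capital α lam R p q N θ (fun i => m i ω)
      (fun i => x i ω) (fun i => r i ω) t} ⊆ {ω | ∃ t ≤ T, ENNReal.ofReal (1 / δ) ≤ Q t ω} :=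
    fun ω ⟨t, ht, h⟩ => ⟨t, ht, ENNReal.ofReal_le_ofReal h⟩
  refine (measure_mono hsubset).trans ?_
  have h1 := mul_le_mul_right (hville.trans hQ0) (ENNReal.ofReal δ)
  rwa [← mul_assoc, ← ENNReal.ofReal_mul hδ.le, mul_one_div_cancel hδ.ne', ENNReal.ofReal_one,
    one_mul, mul_one] at h1

end Event

/-! ### Simultaneous noise bounds -/

section NoiseBound

theorem qnorm_le_of_scaled {d : ℕ} {R B : ℝ} (hR : 0 < R) {A : Mat d} {v : Fin d → ℝ}
    (h : (R⁻¹ • v) ⬝ᵥ A *ᵥ (R⁻¹ • v) ≤ B) : qnorm A v ≤ R * √B := by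
  rw [mulVec_smul, smul_dotProduct, dotProduct_smul, smul_eq_mul, smul_eq_mul] at h
  rw [qnorm, ← Real.sqrt_sq hR.le, ← Real.sqrt_mul (sq_nonneg R)]
  refine Real.sqrt_le_sqrt ?_
  have h1 : v ⬝ᵥ A *ᵥ v = R ^ 2 * (R⁻¹ * (R⁻¹ * (v ⬝ᵥ A *ᵥ v))) := by field_simp
  rw [h1]
  exact mul_le_mul_of_nonneg_left h (sq_nonneg R)

variable {M d : ℕ} {α lam : ℝ}

theorem Valid.log_det_locCov_le {s : State M d} (hs : Valid α lam s) (hα : 0 < α)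
    (hlam : 0 < lam) (k : Fin M) :
    Real.log (locCov α s k).det - Real.log (α • s.cov k).det ≤ 1 := by
  have hA := hs.cov_posDef hlam k
  have hαA := hA.smul hα
  have h1 := det_add_le_exp_trace hαA (hs.loc_gram k)
  have hinv : (α • s.cov k)⁻¹ = α⁻¹ • (s.cov k)⁻¹ :=
    Matrix.inv_smul' _ (Units.mk0 α hα.ne') (isUnit_iff_ne_zero.mpr hA.det_pos.ne')
  have h2 : ((α • s.cov k)⁻¹ * s.covLoc k).trace ≤ 1 := by
    rw [hinv, smul_mul_assoc, trace_smul, smul_eq_mul, inv_mul_le_iff₀ hα, mul_one]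
    exact hs.loc_trace k
  have h3 := Real.log_le_log (hs.locCov_posDef hα hlam k).det_pos h1
  rw [Real.log_mul hαA.det_pos.ne' (Real.exp_pos _).ne', Real.log_exp] at h3
  linarith

theorem locNoise_eq_zero {θ : Vec d} {m : ℕ → Fin M} {x : ℕ → Vec d} {r : ℕ → ℝ} {t : ℕ}
    (h : ∀ i < t, r i = inner ℝ (x i) θ) (k : Fin M) :
    locNoise θ (state α lam m x r t) k = 0 := by
  induction t with
  | zero => simp [locNoise, state, init]
  | succ t ih =>
    have ih := ih fun i hi => h i (hi.trans t.lt_succ_self)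
    have h1 := h t t.lt_succ_self
    rw [locNoise] at ih
    rw [state, locNoise, step_covLoc, step_vecLoc]
    split_ifs with h2 h3
    · simp
    · rw [add_mulVec, outer_mulVec_ofLp, ← h1, WithLp.ofLp_add, WithLp.ofLp_smul,
        add_sub_add_right_eq_sub, ih]
    · exact ih

variable {Ω : Type*} {mΩ : MeasurableSpace Ω} {μ : Measure Ω} [IsProbabilityMeasure μ]
  {m : ℕ → Ω → Fin M} {x : ℕ → Ω → Vec d} {η r : ℕ → Ω → ℝ} {T : ℕ} {θ : Vec d}

/-- Simultaneous self-normalized bounds for the noise of the whole run and for the noise held back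
by every agent, at all times. -/
theorem exists_noise_event {R L p q N δ B : ℝ} (hα : 0 < α) (hlam : 0 < lam) (hR : 0 ≤ R)
    (hδ : 0 < δ) (hp : 0 < p) (hq : 0 < q) (hpq : p + q * (M + N) ≤ 1)
    (hm : ∀ t < T, Measurable (m t)) (hx : ∀ t < T, Measurable (x t))
    (hη : ∀ t < T, Measurable (η t)) (hr : ∀ t < T, ∀ ω, r t ω = inner ℝ (x t ω) θ + η t ω)
    (hnoise : ∀ t < T, CondSubGaussian μ (history m x r t) (η t) R)
    (hL : ∀ t < T, ∀ ω, ‖x t ω‖ ≤ L)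
    (hN : (M + 1 / α) * (d * Real.log (1 + T * L ^ 2 / (lam * d))) ≤ N)
    (hBp : 2 * Real.log (1 / δ / p) + d * Real.log (1 + T * L ^ 2 / (lam * d)) ≤ B)
    (hBq : 2 * Real.log (1 / δ / q) + 1 ≤ B) :
    ∃ E : Set Ω, MeasurableSet E ∧ ENNReal.ofReal (1 - δ) ≤ μ E ∧ ∀ ω ∈ E, ∀ t ≤ T,
      qnorm (totalCov lam (fun i => x i ω) t)⁻¹
        (noiseSum θ (fun i => x i ω) (fun i => r i ω) t) ≤ R * √B ∧
      ∀ k, qnorm (locCov α (state α lam (fun i => m i ω) (fun i => x i ω)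
          (fun i => r i ω) t) k)⁻¹
        (locNoise θ (state α lam (fun i => m i ω) (fun i => x i ω)
          (fun i => r i ω) t) k) ≤ R * √B := by
  have hrm : ∀ t < T, Measurable (r t) := fun t ht => by
    rw [funext (hr t ht)]
    exact ((hx t ht).inner measurable_const).add (hη t ht)
  rcases hR.eq_or_lt with rfl | hR
  · have hE : MeasurableSet (⋂ t ∈ Finset.range T, {ω | η t ω = 0}) :=
      Finset.measurableSet_biInter _ fun t ht =>
        hη t (Finset.mem_range.mp ht) (measurableSet_singleton 0)
    refine ⟨_, hE, ?_, ?_⟩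
    · have hae : ∀ᵐ ω ∂μ, ω ∈ ⋂ t ∈ Finset.range T, {ω | η t ω = 0} := by
        simp only [Set.mem_iInter, Finset.mem_range]
        refine ae_all_iff.mpr fun t => ?_
        by_cases ht : t < T
        · filter_upwards [(hnoise t ht).ae_eq_zero (history_le
            (fun i hi => hm i (hi.trans_lt ht)) (fun i hi => hx i (hi.trans_lt ht))
            (fun i hi => hrm i (hi.trans ht)))] with ω hω _ using hω
        · exact Filter.Eventually.of_forall fun ω h => absurd h ht
      rw [(mem_ae_iff_prob_eq_one hE).mp hae]
      exact ENNReal.ofReal_le_one.mpr (by linarith)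
    · intro ω hω t ht
      simp only [Set.mem_iInter, Finset.mem_range, Set.mem_ofPred_eq] at hω
      have h0 : ∀ i < t, r i ω = inner ℝ (x i ω) θ := fun i hi => by
        rw [hr i (hi.trans_le ht), hω i (hi.trans_le ht), add_zero]
      have hsum : noiseSum θ (fun i => x i ω) (fun i => r i ω) t = 0 :=
        Finset.sum_eq_zero fun i hi => by simp [h0 i (Finset.mem_range.mp hi)]
      refine ⟨by simp [hsum, qnorm_zero], fun k => ?_⟩
      rw [locNoise_eq_zero h0, qnorm_zero, zero_mul]
  · have hcount : ∀ t ≤ T, ∀ ω, trigCount α lam (fun i => m i ω) (fun i => x i ω)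
        (fun i => r i ω) t ≤ N := fun t ht ω =>
      (trigCount_le_log hα hlam ht fun i hi => hL i (hi.trans_le ht) ω).trans hN
    have hmeas := measure_capital_ge_le hα hlam hR hδ hp.le hq.le hpq hm hx hη hr hnoise hcount
    set bad := {ω | ∃ t ≤ T, 1 / δ ≤ capital α lam R p q N θ (fun i => m i ω) (fun i => x i ω)
      (fun i => r i ω) t} with hbad
    have hbadm : MeasurableSet bad := by
      have : bad = ⋃ t ∈ Set.Iic T, {ω | 1 / δ ≤ capital α lam R p q N θ (fun i => m i ω)
          (fun i => x i ω) (fun i => r i ω) t} := by ext; simp [hbad]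
      rw [this]
      exact MeasurableSet.biUnion (Set.to_countable _) fun t ht =>
        measurableSet_le measurable_const (measurable_capital θ
          (fun i hi => hm i (hi.trans_le ht)) (fun i hi => hx i (hi.trans_le ht))
          (fun i hi => hrm i (hi.trans_le ht)))
    refine ⟨badᶜ, hbadm.compl, ?_, ?_⟩
    · rw [prob_compl_eq_one_sub hbadm, ENNReal.ofReal_sub _ hδ.le, ENNReal.ofReal_one]
      exact tsub_le_tsub_left hmeas 1
    · intro ω hω t ht
      have hcap : capital α lam R p q N θ (fun i => m i ω) (fun i => x i ω)
          (fun i => r i ω) t < 1 / δ := by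
        by_contra h
        exact hω ⟨t, ht, not_lt.mp h⟩
      have hs := valid_state (α := α) (lam := lam) (m := fun i => m i ω) (x := fun i => x i ω)
        (r := fun i => r i ω) hα hlam t
      have hcnt := hcount t ht ω
      rw [capital] at hcap
      set s := state α lam (fun i => m i ω) (fun i => x i ω) (fun i => r i ω) t
      have hall0 : 0 ≤ p * allWealth lam R θ (fun i => x i ω) (fun i => r i ω) t :=
        mul_nonneg hp.le (wealth_nonneg _ _ _)
      have hloc0 : ∀ k ∈ Finset.univ, 0 ≤ locWealth α R θ s k := fun k _ => wealth_nonneg _ _ _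
      have hsum0 := Finset.sum_nonneg hloc0
      constructor
      · have h1 : allWealth lam R θ (fun i => x i ω) (fun i => r i ω) t ≤ 1 / δ / p := by
          rw [le_div_iff₀ hp]
          have := mul_nonneg hq.le (add_nonneg hsum0 (sub_nonneg.mpr hcnt))
          linarith
        have h2 := quad_le_of_wealth_le (totalCov_posDef hlam t) (posDef_smul_one hlam) h1
        have h3 := log_totalCov_sub_le (x := fun i => x i ω) hlam ht
          (fun i hi => hL i (hi.trans_le ht) ω)
        exact qnorm_le_of_scaled hR (by linarith)
      · intro k
        have h1 : locWealth α R θ s k ≤ 1 / δ / q := by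
          rw [le_div_iff₀ hq]
          have h2 := Finset.single_le_sum hloc0 (Finset.mem_univ k)
          have h3 : q * locWealth α R θ s k ≤ q * (∑ k, locWealth α R θ s k + (N -
              trigCount α lam (fun i => m i ω) (fun i => x i ω) (fun i => r i ω) t)) :=
            mul_le_mul_of_nonneg_left (by linarith) hq.le
          linarith
        have h2 := quad_le_of_wealth_le (hs.locCov_posDef hα hlam k)
          ((hs.cov_posDef hlam k).smul hα) h1
        have h3 := hs.log_det_locCov_le hα hlam k
        exact qnorm_le_of_scaled hR (by linarith)

end NoiseBound

/-! ### The constants -/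

section Constants

/-- The constants when the regret bound does not follow from the trivial one: there
`y = T L² / λ` is so large that the `M + (M + 1 / α) G` batches of held-back data are few compared
with `K = y / min α 1`. -/
theorem constants_of_nontrivial {M α y K G : ℝ} {d : ℕ} (hα : 0 < α) (hM : 1 ≤ M) (hd : 2 ≤ d)
    (hy0 : 0 ≤ y) (hK : y / α ≤ K) (hG : G = d * Real.log (1 + y))
    (h : 4 * (1 + M * α) * (1 + √(1 + M * α) + M * √(2 * α)) ^ 2 * G < y) :
    31 ≤ y ∧ 2 ≤ G ∧ 16 * (M + (M + 1 / α) * G) ≤ K := by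
  have hd' : (2 : ℝ) ≤ d := by exact_mod_cast hd
  have hlog : 0 ≤ Real.log (1 + y) := Real.log_nonneg (by linarith)
  have hG0 : 0 ≤ G := by rw [hG]; positivity
  have hMα : 0 < M * α := by positivity
  have hκ : 4 + 2 * α * M ^ 2 ≤ (1 + √(1 + M * α) + M * √(2 * α)) ^ 2 := by
    have h1 : 1 ≤ √(1 + M * α) := Real.one_le_sqrt.mpr (by linarith)
    have h2 : √(2 * α) ^ 2 = 2 * α := Real.sq_sqrt (by positivity)
    have h3 : 0 ≤ M * √(2 * α) := by positivity
    have h4 : (M * √(2 * α)) ^ 2 = 2 * α * M ^ 2 := by rw [mul_pow, h2]; ring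
    have h5 : 2 ^ 2 ≤ (1 + √(1 + M * α)) ^ 2 := pow_le_pow_left₀ zero_le_two (by linarith) 2
    have h6 : 0 ≤ (1 + √(1 + M * α)) * (M * √(2 * α)) := by positivity
    linarith [add_sq (1 + √(1 + M * α)) (M * √(2 * α))]
  have h1 : 4 * (1 + M * α) * (4 + 2 * α * M ^ 2) * G < y :=
    lt_of_le_of_lt (mul_le_mul_of_nonneg_right
      (mul_le_mul_of_nonneg_left hκ (by positivity)) hG0) h
  have h2 : 16 * G + 16 * (M * α * G) + 8 * (α * M ^ 2 * G) < y := by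
    have : 0 ≤ M * α * (α * M ^ 2 * G) := by positivity
    linarith
  have h16 : 16 * G < y := by
    have : 0 ≤ M * α * G := by positivity
    have : 0 ≤ α * M ^ 2 * G := by positivity
    linarith
  have hy1 : 31 ≤ y := by
    have h3 := Real.one_sub_inv_le_log_of_pos (by linarith : 0 < 1 + y)
    have h4 : 32 * Real.log (1 + y) ≤ 16 * G := by rw [hG]; nlinarith
    have h5 : 32 * (1 - (1 + y)⁻¹) < y := by linarith
    have h6 : 1 - (1 + y)⁻¹ = y / (1 + y) := by field_simp; ring
    rw [h6, ← mul_div_assoc, div_lt_iff₀ (by linarith)] at h5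
    nlinarith
  have hG2 : 2 ≤ G := by
    have h3 : 1 ≤ Real.log (1 + y) := by
      rw [Real.le_log_iff_exp_le (by linarith)]
      linarith [Real.exp_one_lt_d9]
    rw [hG]
    nlinarith
  refine ⟨hy1, hG2, le_trans ?_ hK⟩
  rw [le_div_iff₀ hα]
  have h7 : 16 * (M + (M + 1 / α) * G) * α = 16 * (M * α) + 16 * (M * α * G) + 16 * G := by
    field_simp
    ring
  rw [h7]
  have h8 : M * α * 2 ≤ M * α * G := mul_le_mul_of_nonneg_left hG2 hMα.le
  have h9 : M * α * G ≤ α * M ^ 2 * G := by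
    refine mul_le_mul_of_nonneg_right ?_ hG0
    nlinarith
  linarith

/-- The two stakes of the capital, and the confidence level they lead to. -/
theorem stakes_of_nontrivial {M N y K δ : ℝ} {d : ℕ} (hd : 2 ≤ d) (hδ : 0 < δ) (hδ1 : δ ≤ 1)
    (hy : 31 ≤ y) (hyK : y ≤ K) (hK : 16 * (M + N) ≤ K) :
    (1 + y / 2) / (1 + y) + 2 / (1 + K) * (M + N) ≤ 1 ∧
    2 * Real.log (1 / δ / ((1 + y / 2) / (1 + y))) + d * Real.log (1 + y / d) ≤
      d * Real.log ((1 + K) / δ) ∧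
    2 * Real.log (1 / δ / (2 / (1 + K))) + 1 ≤ d * Real.log ((1 + K) / δ) := by
  have hd' : (2 : ℝ) ≤ d := by exact_mod_cast hd
  have hδl : Real.log δ ≤ 0 := Real.log_nonpos hδ.le hδ1
  have hy1 : 0 < 1 + y := by linarith
  have hy2 : 0 < 1 + y / 2 := by linarith
  have hK1 : 0 < 1 + K := by linarith
  rw [Real.log_div hK1.ne' hδ.ne']
  have hyK' : Real.log (1 + y) ≤ Real.log (1 + K) := Real.log_le_log hy1 (by linarith)
  refine ⟨?_, ?_, ?_⟩
  · have h1 : 2 / (1 + K) * (M + N) ≤ 1 / 8 := by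
      rw [div_mul_eq_mul_div, div_le_iff₀ hK1]
      linarith
    have h2 : (1 + y / 2) / (1 + y) ≤ 7 / 8 := by
      rw [div_le_iff₀ hy1]
      linarith
    linarith
  · rw [Real.log_div (by positivity) (by positivity), Real.log_div one_ne_zero hδ.ne',
      Real.log_one, Real.log_div hy2.ne' hy1.ne']
    have h1 : Real.log (1 + y / d) ≤ Real.log (1 + y / 2) := by
      refine Real.log_le_log (by positivity) ?_
      have : y / d ≤ y / 2 := div_le_div_of_nonneg_left (by linarith) (by norm_num) hd'
      linarith
    have h2 : Real.log (1 + y / 2) ≤ Real.log (1 + y) := Real.log_le_log hy2 (by linarith)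
    nlinarith
  · rw [Real.log_div (by positivity) (by positivity), Real.log_div one_ne_zero hδ.ne',
      Real.log_one, Real.log_div two_ne_zero hK1.ne']
    have h1 := Real.log_two_gt_d9
    have h2 : 0 ≤ Real.log (1 + K) := Real.log_nonneg (by linarith)
    nlinarith

end Constants

/-! ### The regret bound -/

section RegretBound

variable {M d T : ℕ} {α lam β δ R S L : ℝ}

theorem regret_le_trivial {θ : Vec d} {D : ℕ → Set (Vec d)} {m : ℕ → Fin M} {x : ℕ → Vec d}
    {r : ℕ → ℝ} (hθ : ‖θ‖ ≤ S) (hD : ∀ t < T, ∀ y ∈ D t, ‖y‖ ≤ L)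
    (hrun : IsRun α β lam T D m x r) : regret θ T D x ≤ T * (2 * S * L) := by
  rw [regret]
  refine (Finset.sum_le_sum fun t ht => regret_term_le hθ (hD t (Finset.mem_range.mp ht))
    (hrun t (Finset.mem_range.mp ht)).1).trans ?_
  simp

theorem trivial_bound_le {G M : ℝ} (hα : 0 < α) (hM : 0 ≤ M) (hlam : 0 < lam) (hS : 0 ≤ S)
    (hG : 0 ≤ G) (hβ : √lam * S * (1 + √(1 + M * α) + M * √(2 * α)) ≤ β)
    (h : T * L ^ 2 / lam ≤ 4 * (1 + M * α) * (1 + √(1 + M * α) + M * √(2 * α)) ^ 2 * G) :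
    T * (2 * S * L) ≤ 2 * β * √(4 * (1 + M * α) * (T * G)) := by
  set κ := 1 + √(1 + M * α) + M * √(2 * α) with hκ
  have hκ0 : 0 ≤ κ := by positivity
  rw [div_le_iff₀ hlam] at h
  have hT : (0 : ℝ) ≤ T := Nat.cast_nonneg T
  have h1 : T * L ≤ √lam * κ * √(4 * (1 + M * α) * (T * G)) := by
    refine le_of_sq_le_sq ?_ (by positivity)
    rw [mul_pow, mul_pow, mul_pow, Real.sq_sqrt hlam.le, Real.sq_sqrt (by positivity)]
    have := mul_le_mul_of_nonneg_left h hT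
    nlinarith
  have h2 := mul_le_mul_of_nonneg_left h1 hS
  have h3 := mul_le_mul_of_nonneg_right hβ (Real.sqrt_nonneg (4 * (1 + M * α) * (T * G)))
  nlinarith

variable {Ω : Type*} {mΩ : MeasurableSpace Ω} {μ : Measure Ω} [IsProbabilityMeasure μ]
  {m : ℕ → Ω → Fin M} {x : ℕ → Ω → Vec d} {η r : ℕ → Ω → ℝ} {θ : Vec d}
  {D : ℕ → Ω → Set (Vec d)}

theorem regret_bound (hα : 0 < α) (hlam : 0 < lam) (hδ0 : 0 < δ) (hδ1 : δ < 1) (hR : 0 ≤ R)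
    (hm : ∀ t < T, Measurable (m t)) (hx : ∀ t < T, Measurable (x t))
    (hη : ∀ t < T, Measurable (η t))
    (hr : ∀ t < T, ∀ ω, r t ω = inner ℝ (x t ω) θ + η t ω)
    (hnoise : ∀ t < T, CondSubGaussian μ (history m x r t) (η t) R)
    (hθ : ‖θ‖ ≤ S) (hD : ∀ t < T, ∀ ω, ∀ y ∈ D t ω, ‖y‖ ≤ L)
    (hβ : β = √lam * S + (√(1 + M * α) + M * √(2 * α)) *
      (R * √(d * Real.log ((1 + T * L ^ 2 / (min α 1 * lam)) / δ)) + √lam * S))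
    (hrun : ∀ ω, IsRun α β lam T (fun t => D t ω) (fun t => m t ω) (fun t => x t ω)
      (fun t => r t ω)) (hd : 2 ≤ d) :
    ∃ E : Set Ω, MeasurableSet E ∧ ENNReal.ofReal (1 - δ) ≤ μ E ∧ ∀ ω ∈ E,
      regret θ T (fun t => D t ω) (fun t => x t ω) ≤
        2 * d * S * L * M * Real.log (1 + T * L ^ 2 / lam) +
          2 * √(2 * (1 + M * α)) * β * √(2 * d * T * Real.log (1 + T * L ^ 2 / lam)) := by
  obtain ⟨ω₀⟩ : Nonempty Ω := nonempty_of_isProbabilityMeasure μ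
  have hM : (1 : ℝ) ≤ M := by exact_mod_cast (m 0 ω₀).pos
  have hS : 0 ≤ S := (norm_nonneg _).trans hθ
  set y := T * L ^ 2 / lam with hy
  set G := d * Real.log (1 + y) with hG
  set ρ := R * √(d * Real.log ((1 + T * L ^ 2 / (min α 1 * lam)) / δ)) with hρ
  have hρ0 : 0 ≤ ρ := by positivity
  have hy0 : 0 ≤ y := by positivity
  have hG0 : 0 ≤ G := mul_nonneg (Nat.cast_nonneg d) (Real.log_nonneg (by linarith))
  have hβκ : √lam * S * (1 + √(1 + M * α) + M * √(2 * α)) ≤ β := by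
    have : 0 ≤ (√(1 + M * α) + M * √(2 * α)) * ρ := by positivity
    rw [hβ]
    linarith
  have hβ0 : 0 ≤ β := le_trans (by positivity) hβκ
  have hrhs : 2 * √(2 * (1 + M * α)) * β * √(2 * d * T * Real.log (1 + y)) =
      2 * β * √(4 * (1 + M * α) * (T * G)) := by
    have h1 : 4 * (1 + M * α) * (T * G) =
        (2 * (1 + M * α)) * (2 * d * T * Real.log (1 + y)) := by rw [hG]; ring
    rw [h1, Real.sqrt_mul (by positivity : 0 ≤ 2 * (1 + M * α)) (2 * d * T * Real.log (1 + y))]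
    ring
  have hfirst : 2 * d * S * L * M * Real.log (1 + y) = 2 * S * L * (M * G) := by rw [hG]; ring
  rw [hrhs, hfirst]
  rcases Nat.eq_zero_or_pos T with rfl | hT
  · refine ⟨Set.univ, MeasurableSet.univ, ?_, fun ω _ => ?_⟩
    · rw [measure_univ]
      exact ENNReal.ofReal_le_one.mpr (by linarith)
    · simp [regret, hG, hy]
  have hL : 0 ≤ L := (norm_nonneg _).trans (hD 0 hT ω₀ _ (hrun ω₀ 0 hT).1)
  have hxL : ∀ t < T, ∀ ω, ‖x t ω‖ ≤ L := fun t ht ω => hD t ht ω _ (hrun ω t ht).1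
  rcases le_or_gt y (4 * (1 + M * α) * (1 + √(1 + M * α) + M * √(2 * α)) ^ 2 * G) with h | h
  · -- the bound exceeds `2 S L T`
    refine ⟨Set.univ, MeasurableSet.univ, ?_, fun ω _ => ?_⟩
    · rw [measure_univ]
      exact ENNReal.ofReal_le_one.mpr (by linarith)
    · have h1 := regret_le_trivial hθ (fun t ht => hD t ht ω) (hrun ω)
      have h2 := trivial_bound_le (T := T) hα (by linarith) hlam hS hG0 hβκ h
      have h3 : 0 ≤ 2 * S * L * (M * G) := by positivity
      linarith
  · set K := T * L ^ 2 / (min α 1 * lam) with hK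
    have hmin : 0 < min α 1 := lt_min hα one_pos
    have hKy : K = y / min α 1 := by rw [hK, hy, mul_comm (min α 1), div_div]
    have hyα : y / α ≤ K := by
      rw [hKy]; exact div_le_div_of_nonneg_left hy0 hmin (min_le_left _ _)
    have hyK : y ≤ K := by
      rw [hKy]; exact le_div_self hy0 hmin (min_le_right _ _)
    obtain ⟨hy31, hG2, hKG⟩ := constants_of_nontrivial hα hM hd hy0 hyα hG h
    obtain ⟨hpq, hBp, hBq⟩ := stakes_of_nontrivial hd hδ0 hδ1.le hy31 hyK hKG
    have hyd : T * L ^ 2 / (lam * d) = y / d := by rw [hy, div_div]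
    have hd0 : (1 : ℝ) ≤ d := by exact_mod_cast (by omega : 1 ≤ d)
    have hG' : d * Real.log (1 + T * L ^ 2 / (lam * d)) ≤ G := by
      rw [hyd, hG]
      refine mul_le_mul_of_nonneg_left (Real.log_le_log (by positivity) ?_) (Nat.cast_nonneg d)
      linarith [div_le_self hy0 hd0]
    obtain ⟨E, hE, hμE, hgood⟩ := exists_noise_event (μ := μ) (p := (1 + y / 2) / (1 + y))
      (q := 2 / (1 + K)) (N := (M + 1 / α) * G) hα hlam hR hδ0 (by positivity)
      (div_pos two_pos (by linarith)) hpq hm hx hη hr hnoise hxL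
      (mul_le_mul_of_nonneg_left hG' (by positivity)) (by rw [hyd]; exact hBp) hBq
    refine ⟨E, hE, hμE, fun ω hω => ?_⟩
    have hconf : ∀ t < T, qnorm ((state α lam (fun i => m i ω) (fun i => x i ω)
        (fun i => r i ω) t).cov (m t ω)) (((state α lam (fun i => m i ω) (fun i => x i ω)
        (fun i => r i ω) t).est (m t ω)).ofLp - θ.ofLp) ≤ β := by
      intro t ht
      refine (agent_confidence hα hlam θ hθ hρ0 (fun t ht => (hgood ω hω t ht).1)
        (fun t ht => (hgood ω hω t ht).2) ht.le _).trans ?_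
      rw [hβ]
      have : 0 ≤ (√(1 + M * α) + M * √(2 * α)) * (√lam * S) := by positivity
      linarith
    have hdet : Real.log (state α lam (fun i => m i ω) (fun i => x i ω) (fun i => r i ω)
        T).covSer.det - Real.log (lam • (1 : Mat d)).det ≤ G := by
      have h1 := log_covSer_le_totalCov (m := fun i => m i ω) (x := fun i => x i ω)
        (r := fun i => r i ω) hα hlam T
      have h2 := log_totalCov_sub_le hlam le_rfl (fun i hi => hxL i hi ω)
      linarith
    refine (regret_le_of_confidence hα hlam hβ0 hL hθ (fun t ht => hD t ht ω) (hrun ω) hconf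
      hdet).trans ?_
    have hMα : 0 ≤ M * α := by positivity
    have hsqrt : √(T * (M * α + (M * α + 2) * G)) ≤ √(4 * (1 + M * α) * (T * G)) := by
      refine Real.sqrt_le_sqrt ?_
      have h1 : M * α + (M * α + 2) * G ≤ 4 * (1 + M * α) * G := by nlinarith
      have := mul_le_mul_of_nonneg_left h1 (Nat.cast_nonneg (α := ℝ) T)
      linarith
    have := mul_le_mul_of_nonneg_left hsqrt (by positivity : 0 ≤ 2 * β)
    linarith

/-- The second term of the regret bound for `α = 1 / M²`; the constants are worst at `M = 1`. -/
theorem second_term_le {M lT ℓ : ℝ} (hd : 1 ≤ d) (hM : 1 ≤ M) (hR : 0 ≤ R) (hS : 0 ≤ S)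
    (hlT : lT ≤ ℓ) (hℓ : 0 ≤ ℓ) (hα : α = 1 / M ^ 2)
    (hβ : β = √lam * S + (√(1 + M * α) + M * √(2 * α)) * (R * √(d * ℓ) + √lam * S)) :
    2 * √(2 * (1 + M * α)) * β * √(2 * d * T * lT) ≤
      (22 * √lam * S * √ℓ + 16 * R * ℓ) * d * √T := by
  have hM0 : 0 < M := by linarith
  have hd' : (1 : ℝ) ≤ d := by exact_mod_cast hd
  have hMα : M * α ≤ 1 := by
    have : M * α = 1 / M := by rw [hα]; field_simp
    rw [this]
    exact (div_le_one hM0).mpr hM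
  have hMα' : 0 ≤ M * α := by rw [hα]; positivity
  have hs1 : √(2 * (1 + M * α)) ≤ 2 := by
    rw [Real.sqrt_le_left (by norm_num)]
    linarith
  have hs2 : √(1 + M * α) ≤ √2 := Real.sqrt_le_sqrt (by linarith)
  have hs3 : M * √(2 * α) = √2 := by
    rw [Real.sqrt_mul (by norm_num), hα, Real.sqrt_div zero_le_one, Real.sqrt_one,
      Real.sqrt_sq hM0.le]
    field_simp
  have hs4 : √(2 * d * T * lT) ≤ √2 * (√d * √T * √ℓ) := by
    rw [← Real.sqrt_mul (by positivity), ← Real.sqrt_mul (by positivity),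
      ← Real.sqrt_mul (by norm_num)]
    refine Real.sqrt_le_sqrt ?_
    have := mul_le_mul_of_nonneg_left hlT (by positivity : (0 : ℝ) ≤ 2 * d * T)
    linarith
  have hdd : √(d : ℝ) ^ 2 = d := Real.sq_sqrt (by linarith)
  have hdle : √(d : ℝ) ≤ d := by
    have : 1 ≤ √(d : ℝ) := Real.one_le_sqrt.mpr hd'
    nlinarith
  have hℓℓ : √ℓ ^ 2 = ℓ := Real.sq_sqrt hℓ
  have h22 : √2 ^ 2 = (2 : ℝ) := Real.sq_sqrt (by norm_num)
  have h2le : √2 ≤ (3 / 2 : ℝ) := by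
    rw [Real.sqrt_le_left (by norm_num)]
    norm_num
  have hβle : β ≤ √lam * S * (1 + 2 * √2) + 2 * √2 * (R * (√d * √ℓ)) := by
    rw [hβ, hs3, Real.sqrt_mul (by positivity)]
    have h0 : 0 ≤ R * (√d * √ℓ) + √lam * S := by positivity
    have := mul_le_mul_of_nonneg_right (by linarith : √(1 + M * α) + √2 ≤ 2 * √2) h0
    linarith
  have hβ0 : 0 ≤ β := by rw [hβ]; positivity
  have hX : 0 ≤ √d * √T * √ℓ := by positivity
  calc 2 * √(2 * (1 + M * α)) * β * √(2 * d * T * lT)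
      ≤ 2 * 2 * (√lam * S * (1 + 2 * √2) + 2 * √2 * (R * (√d * √ℓ))) *
          (√2 * (√d * √T * √ℓ)) := by gcongr
    _ = (4 * √2 + 8 * √2 ^ 2) * (√lam * S * √ℓ * √T) * √d +
          8 * √2 ^ 2 * R * √ℓ ^ 2 * √d ^ 2 * √T := by ring
    _ ≤ 22 * (√lam * S * √ℓ * √T) * d + 16 * R * ℓ * d * √T := by
        rw [h22, hℓℓ, hdd]
        gcongr
        · linarith
        · norm_num
    _ = (22 * √lam * S * √ℓ + 16 * R * ℓ) * d * √T := by ring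

end RegretBound

end FedLinUCB

theorem theorem1
    {Ω : Type*} [MeasurableSpace Ω] (μ : Measure Ω) [IsProbabilityMeasure μ]
    (M d T : ℕ)
    (α β lam δ R S L : ℝ)
    (hα : 0 < α) (hlam : 0 < lam) (hδ0 : 0 < δ) (hδ1 : δ < 1) (hR : 0 ≤ R)
    (θ : FedLinUCB.Vec d)
    -- active agents, decision sets, actions, noise and rewards
    (m : ℕ → Ω → Fin M) (D : ℕ → Ω → Set (FedLinUCB.Vec d))
    (x : ℕ → Ω → FedLinUCB.Vec d) (η r : ℕ → Ω → ℝ)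
    (hm : ∀ t < T, Measurable (m t)) (hx : ∀ t < T, Measurable (x t))
    (hη : ∀ t < T, Measurable (η t))
    (hr : ∀ t < T, ∀ ω, r t ω = inner ℝ (x t ω) θ + η t ω)
    (hnoise : ∀ t < T, FedLinUCB.CondSubGaussian μ (FedLinUCB.history m x r t) (η t) R)
    (hθ : ‖θ‖ ≤ S)
    (hD : ∀ t < T, ∀ ω, ∀ y ∈ D t ω, ‖y‖ ≤ L)
    -- the confidence radius
    (hβ : β = Real.sqrt lam * S + (Real.sqrt (1 + M * α) + M * Real.sqrt (2 * α)) *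
      (R * Real.sqrt (d * Real.log ((1 + T * L ^ 2 / (min α 1 * lam)) / δ)) + Real.sqrt lam * S))
    -- the actions are those of the algorithm
    (hrun : ∀ ω, FedLinUCB.IsRun α β lam T (fun t => D t ω)
      (fun t => m t ω) (fun t => x t ω) (fun t => r t ω)) :
    -- regret
    (2 ≤ d → ∃ E : Set Ω, MeasurableSet E ∧ ENNReal.ofReal (1 - δ) ≤ μ E ∧ ∀ ω ∈ E,
      FedLinUCB.regret θ T (fun t => D t ω) (fun t => x t ω) ≤
        2 * d * S * L * M * Real.log (1 + T * L ^ 2 / lam) +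
          2 * Real.sqrt (2 * (1 + M * α)) * β *
            Real.sqrt (2 * d * T * Real.log (1 + T * L ^ 2 / lam))) ∧
    -- communication complexity and switching cost
    (∀ ω, (FedLinUCB.commComplexity α lam T
        (fun t => m t ω) (fun t => x t ω) (fun t => r t ω) : ℝ) ≤
      2 / Real.log 2 * d * (M + 1 / α) * Real.log (1 + T * L ^ 2 / (lam * d))) ∧
    (∀ ω, (FedLinUCB.switchingCost α lam T
        (fun t => m t ω) (fun t => x t ω) (fun t => r t ω) : ℝ) ≤
      2 * Real.log 2 * d * (M + 1 / α) * Real.log (1 + T * L ^ 2 / (lam * d))) ∧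
    -- the choice `α = 1 / M ^ 2`
    (α = 1 / (M : ℝ) ^ 2 →
      (2 ≤ d → ∃ E : Set Ω, MeasurableSet E ∧ ENNReal.ofReal (1 - δ) ≤ μ E ∧ ∀ ω ∈ E,
        FedLinUCB.regret θ T (fun t => D t ω) (fun t => x t ω) ≤
          (22 * Real.sqrt lam * S * Real.sqrt (Real.log ((1 + T * M ^ 2 * L ^ 2 / lam) / δ)) +
            16 * R * Real.log ((1 + T * M ^ 2 * L ^ 2 / lam) / δ)) * d * Real.sqrt T +
          2 * d * S * L * M * Real.log (1 + T * L ^ 2 / lam)) ∧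
      (∀ ω, (FedLinUCB.commComplexity α lam T
          (fun t => m t ω) (fun t => x t ω) (fun t => r t ω) : ℝ) ≤
        4 / Real.log 2 * d * M ^ 2 * Real.log (1 + T * L ^ 2 / (lam * d))) ∧
      (∀ ω, (FedLinUCB.switchingCost α lam T
          (fun t => m t ω) (fun t => x t ω) (fun t => r t ω) : ℝ) ≤
        4 * Real.log 2 * d * M ^ 2 * Real.log (1 + T * L ^ 2 / (lam * d)))) := by
  obtain ⟨ω₀⟩ : Nonempty Ω := nonempty_of_isProbabilityMeasure μ
  have hM : (1 : ℝ) ≤ M := by exact_mod_cast (m 0 ω₀).pos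
  have hx0 : ∀ ω, ∀ t < T, ‖x t ω‖ ≤ L := fun ω t ht => hD t ht ω _ (hrun ω t ht).1
  have hregret := FedLinUCB.regret_bound hα hlam hδ0 hδ1 hR hm hx hη hr hnoise hθ hD hβ hrun
  have hX : 0 ≤ d * Real.log (1 + T * L ^ 2 / (lam * d)) :=
    mul_nonneg (Nat.cast_nonneg d)
      (Real.log_nonneg (le_add_of_nonneg_right (by positivity)))
  set X := d * Real.log (1 + T * L ^ 2 / (lam * d)) with hXdef
  have hcount : ∀ ω, FedLinUCB.trigCount α lam (fun t => m t ω) (fun t => x t ω)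
      (fun t => r t ω) T ≤ (M + 1 / α) * X := fun ω =>
    FedLinUCB.trigCount_le_log hα hlam le_rfl (hx0 ω)
  have hYX : 0 ≤ (M + 1 / α) * X := mul_nonneg (by positivity) hX
  have hlog2 : 0 < Real.log 2 := Real.log_pos one_lt_two
  have hlog2' : 1 ≤ 1 / Real.log 2 := by
    rw [le_div_iff₀ hlog2, one_mul]
    linarith [Real.log_two_lt_d9]
  have hlog2'' : 1 ≤ 2 * Real.log 2 := by linarith [Real.log_two_gt_d9]
  have hcomm : ∀ ω, (FedLinUCB.commComplexity α lam T
      (fun t => m t ω) (fun t => x t ω) (fun t => r t ω) : ℝ) ≤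
      2 * (1 / Real.log 2) * ((M + 1 / α) * X) := by
    intro ω
    rw [FedLinUCB.commComplexity_eq]
    have := le_mul_of_one_le_left hYX hlog2'
    linarith [hcount ω]
  have hswitch : ∀ ω, (FedLinUCB.switchingCost α lam T
      (fun t => m t ω) (fun t => x t ω) (fun t => r t ω) : ℝ) ≤
      2 * Real.log 2 * ((M + 1 / α) * X) := fun ω =>
    (FedLinUCB.switchingCost_le T).trans ((hcount ω).trans
      (le_mul_of_one_le_left hYX hlog2''))
  refine ⟨hregret, fun ω => (hcomm ω).trans_eq ?_, fun ω => (hswitch ω).trans_eq ?_,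
    fun hαM => ?_⟩
  · rw [hXdef]; ring
  · rw [hXdef]; ring
  have hM0 : (0 : ℝ) < M := by linarith
  have hMα : (M + 1 / α) * X ≤ 2 * M ^ 2 * X := by
    refine mul_le_mul_of_nonneg_right ?_ hX
    rw [hαM, one_div_one_div]
    nlinarith
  refine ⟨fun hd => ?_, fun ω => (hcomm ω).trans ?_, fun ω => (hswitch ω).trans ?_⟩
  · obtain ⟨E, hE, hμE, hreg⟩ := hregret hd
    refine ⟨E, hE, hμE, fun ω hω => (hreg ω hω).trans ?_⟩
    have hα1 : α ≤ 1 := by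
      rw [hαM]
      exact (div_le_one (by positivity)).mpr (one_le_pow₀ hM)
    have hK : T * L ^ 2 / (min α 1 * lam) = T * M ^ 2 * L ^ 2 / lam := by
      rw [min_eq_left hα1, hαM]
      field_simp
    rw [hK] at hβ
    have hy : 0 ≤ T * L ^ 2 / lam := by positivity
    have hyK : T * L ^ 2 / lam ≤ T * M ^ 2 * L ^ 2 / lam := by
      refine div_le_div_of_nonneg_right ?_ hlam.le
      have h1 : (T : ℝ) * 1 ≤ T * M ^ 2 :=
        mul_le_mul_of_nonneg_left (one_le_pow₀ hM) (Nat.cast_nonneg T)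
      have := mul_le_mul_of_nonneg_right h1 (sq_nonneg L)
      linarith
    have hlT : Real.log (1 + T * L ^ 2 / lam) ≤
        Real.log ((1 + T * M ^ 2 * L ^ 2 / lam) / δ) := by
      refine Real.log_le_log (by linarith) ?_
      rw [le_div_iff₀ hδ0]
      nlinarith
    have hℓ := (Real.log_nonneg (by linarith : 1 ≤ 1 + T * L ^ 2 / lam)).trans hlT
    have := FedLinUCB.second_term_le (T := T) (by omega) hM hR ((norm_nonneg _).trans hθ) hlT hℓ
      hαM hβ
    linarith
  · have := mul_le_mul_of_nonneg_left hMα (by positivity : 0 ≤ 2 * (1 / Real.log 2))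
    refine this.trans_eq ?_
    rw [hXdef]; ring
  · have := mul_le_mul_of_nonneg_left hMα (by positivity : 0 ≤ 2 * Real.log 2)
    refine this.trans_eq ?_
    rw [hXdef]; ring
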